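/- Let $0<p<1$ and $P=p+1/p$. Let $\mathcal{C}o_p$ be the class of univalent meromorphic functions $f$ on the unit disk $\mathbb{D}=\{z\in\mathbb{C}:|z|<1\}$ (that is, injective as maps of $\mathbb{D}$ into the Riemann sphere) with a pole at $p$, normalized by $f(0)=0$, $f'(0)=1$, and such that $\mathbb{C}\setminus f(\mathbb{D})$ is convex. For $f\in\mathcal{C}o_p$ write $f(z)=z+a_2z^2+a_3z^3+\cdots$ near $0$, and let $W_p=\{a_3-a_2^2 : f\in\mathcal{C}o_p\}$ be the variability region of $a_3-a_2^2$ over $\mathcal{C}o_p$. Let $K(z)=z/(1-z)^2$ be the Koebe function and $\Omega_p=\{-(P^2-4)K(p^2\bar z): |z|\le 1\}$. Then $$\Omega_p\subset W_p\subset\{z\in\mathbb{C}:|z|\le 1\}.$$ Moreover, $W_p=\Omega_p$ for $0<p\le p_0$ and $W_p\ne\Omega_p$ for $p_0<p<1$, where $$p_0=\frac{1+\sqrt{37}-\sqrt{2(1+\sqrt{37})}}{6}\approx 0.553175,$$ the approximation being accurate to within $10^{-6}$. -/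

import Mathlib

noncomputable section

namespace ConcaveFunctions

/-- The map into the Riemann sphere `OnePoint ℂ` given by a meromorphic function in normal form:
it is `∞` at the poles of `f` and `f z` elsewhere. -/
def toSphere (f : ℂ → ℂ) (z : ℂ) : OnePoint ℂ :=
  open Classical in
  if meromorphicOrderAt f z < 0 then OnePoint.infty else ((f z : ℂ) : OnePoint ℂ)

/-- A concave function on the unit disk: a univalent meromorphic function `f` on the unit disk
such that the complement in `ℂ` of its image (in the Riemann sphere) is convex.
The meromorphic function is represented by its normal form, i.e. `f` is analytic on the disk
except at its poles (where the value of the `ℂ`-valued representative is `0` and plays no role). -/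
structure IsConcave (f : ℂ → ℂ) : Prop where
  meromorphic : MeromorphicNFOn f (Metric.ball (0 : ℂ) 1)
  univalent : Set.InjOn (toSphere f) (Metric.ball (0 : ℂ) 1)
  convex_compl : Convex ℝ {w : ℂ | (w : OnePoint ℂ) ∉ toSphere f '' Metric.ball (0 : ℂ) 1}

/-- The class of concave functions with a pole at `p`, normalized by `f 0 = 0`, `f' 0 = 1`. -/
def Co (p : ℝ) : Set (ℂ → ℂ) :=
  {f | IsConcave f ∧ meromorphicOrderAt f (p : ℂ) < 0 ∧ f 0 = 0 ∧ deriv f 0 = 1}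

/-- The `n`-th Taylor coefficient of `f` at the origin. -/
def taylorCoeff (f : ℂ → ℂ) (n : ℕ) : ℂ :=
  iteratedDeriv n f 0 / (n.factorial : ℂ)

/-- The Fekete-Szegő functional `a₃ - μ a₂²`. -/
def feketeSzego (μ : ℝ) (f : ℂ → ℂ) : ℂ :=
  taylorCoeff f 3 - (μ : ℂ) * taylorCoeff f 2 ^ 2

/-- The variability region of `a₃ - a₂²` over the class `Co p`. -/
def variabilityRegion (p : ℝ) : Set ℂ :=
  {w | ∃ f ∈ Co p, w = feketeSzego 1 f}

/-- The Koebe function. -/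
def koebe (z : ℂ) : ℂ := z / (1 - z) ^ 2

/-- The quantity `P = p + 1 / p`. -/
def bigP (p : ℝ) : ℝ := p + 1 / p

/-- The image of the closed unit disk under `z ↦ -(P² - 4) K(p² z̄)`. -/
def koebeRegion (p : ℝ) : Set ℂ :=
  (fun z : ℂ => -((bigP p : ℂ) ^ 2 - 4) * koebe ((p : ℂ) ^ 2 * (starRingEnd ℂ) z)) ''
    Metric.closedBall (0 : ℂ) 1

/-- The critical value of the parameter `p`. -/
def criticalP : ℝ :=
  (1 + Real.sqrt 37 - Real.sqrt (2 * (1 + Real.sqrt 37))) / 6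

end ConcaveFunctions

end

namespace ConcaveFunctions

open Complex Metric Set Filter Topology

/-! Move the pole to the origin by the disk automorphism `poleToZero p`, so that f(z) = H(s)/s with
H holomorphic and H(0) ≠ 0. Put G(s) = H(s)/s. Convexity of the complement is governed by Re c ≥ 0
for c = -(1 + sG''/G') (`curvature`), as for convex functions but with the orientation reversed by
the pole. Since c - 1 vanishes to second order at 0, the Cayley transform of c has the form (c -
1)/(c + 1) = s²ψ(s), with ψ holomorphic and |ψ| ≤ 1 by Schwarz. This is a second-order linear
equation for H. Conversely every such ψ arises: the equation is integrated explicitly, and the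
strict inequality Re c > 0 makes G injective with convex complement.

The quantity a₃ - a₂² is one sixth of the Schwarzian derivative of f at 0. With χ = ψ ∘ `poleToZero
p`, b = χ(0) and b₁ = χ'(0), it equals (-(1 - p²)²b + p(1 - p²)b₁/3)/(1 - p²b)². By Schwarz–Pick
|b₁| ≤ 1 - |b|², so the problem becomes one about two complex numbers.

Constant χ gives b₁ = 0 and exactly the Koebe region. The inclusion in the unit disk is the triangle
inequality. For equality with the Koebe region, membership of a point in K({|v| ≤ q}) is written as
an inequality between |k| and |1 + 4k| (`exists_koebe_eq_iff`). The triangle inequality then reduces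
everything to a real inequality in r = |b|, which is critical as r → 1 and becomes 2p(1 + p²) ≤ 3(1
- p²)². If that fails, a disk automorphism χ with real χ(0) near -1 gives a value beyond the tip of
the region on the positive axis. The critical parameter is the root in (0,1) of this palindromic
quartic.

The analytic core is `re_curvature_nonneg` (necessity), `injective_of_exp` and
`convex_omitted_of_exp` (sufficiency), and `feketeSzego_eq_of_ode` (the formula). -/

/-! ### Tools from one complex variable. -/

/-- An analytic function that is injective near a point has nonzero derivative there. -/
theorem deriv_ne_zero_of_injOn {F : ℂ → ℂ} {a : ℂ} {U : Set ℂ} (hF : AnalyticAt ℂ F a)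
    (hU : U ∈ 𝓝 a) (hinj : InjOn F U) : deriv F a ≠ 0 := by
  have hG : AnalyticAt ℂ (fun z => F z - F a) a := hF.sub analyticAt_const
  have htop : analyticOrderAt (fun z => F z - F a) a ≠ ⊤ := by
    intro h
    rw [analyticOrderAt_eq_top] at h
    have h1 : ∀ᶠ z in 𝓝[≠] a, F z - F a = 0 ∧ z ∈ U ∧ z ≠ a :=
      ((h.and hU).filter_mono nhdsWithin_le_nhds).and self_mem_nhdsWithin |>.mono
        fun z hz => ⟨hz.1.1, hz.1.2, hz.2⟩
    obtain ⟨z, hz, hzU, hza⟩ := h1.exists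
    exact hza (hinj hzU (mem_of_mem_nhds hU) (sub_eq_zero.mp hz))
  obtain ⟨g, hg, hga, hEq⟩ := hG.analyticOrderAt_ne_top.mp htop
  set n := analyticOrderNatAt (fun z => F z - F a) a with hn
  have hF' : F =ᶠ[𝓝 a] fun z => F a + (z - a) ^ n * g z := by
    filter_upwards [hEq] with z hz
    rw [smul_eq_mul] at hz
    rw [← hz]; ring
  have hn0 : n ≠ 0 := by
    intro h0
    have := hEq.self_of_nhds
    simp [h0] at this
    exact hga this.symm
  rcases Nat.lt_or_ge 1 n with hn1 | hn1
  · exfalso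
    -- With an n-th root of g/g(a), F - F(a) becomes g(a)uⁿ with u a local coordinate; then F takes
    -- equal values where u equals e and ζe, for ζ a primitive n-th root of unity.
    set q : ℂ → ℂ := fun z => (g z / g a) ^ ((n : ℂ)⁻¹) with hq
    have hqa : q a = 1 := by simp [hq, div_self hga]
    have hqan : AnalyticAt ℂ q a := by
      refine AnalyticAt.cpow (hg.div analyticAt_const hga) analyticAt_const ?_
      simp [div_self hga]
    set u : ℂ → ℂ := fun z => (z - a) * q z with hu
    have huan : AnalyticAt ℂ u a := (analyticAt_id.sub analyticAt_const).mul hqan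
    have hud : HasStrictDerivAt u 1 a := by
      have h1 : HasDerivAt u (1 * q a + (a - a) * deriv q a) a :=
        ((hasDerivAt_id a).sub_const a).mul hqan.differentiableAt.hasDerivAt
      have := huan.hasStrictDerivAt
      rwa [h1.deriv, hqa, sub_self, zero_mul, add_zero, one_mul] at this
    have hmap := hud.map_nhds_eq one_ne_zero
    have hu0 : u a = 0 := by simp [hu]
    rw [hu0] at hmap
    have hpow : ∀ᶠ z in 𝓝 a, F z = F a + g a * u z ^ n := by
      filter_upwards [hF'] with z hz
      rw [hz, hu]
      have : q z ^ n = g z / g a := Complex.cpow_nat_inv_pow _ hn0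
      simp only [mul_pow, this]
      field_simp
    have hV : {z | F z = F a + g a * u z ^ n} ∩ U ∈ 𝓝 a := inter_mem hpow hU
    have himg : u '' ({z | F z = F a + g a * u z ^ n} ∩ U) ∈ 𝓝 (0 : ℂ) := by
      rw [← hmap]; exact image_mem_map hV
    have hprim := Complex.isPrimitiveRoot_exp n hn0
    set ζ := Complex.exp (2 * Real.pi * I / n)
    have himg2 : ∀ᶠ e in 𝓝 (0 : ℂ), ζ * e ∈ u '' ({z | F z = F a + g a * u z ^ n} ∩ U) := by
      have : Tendsto (fun e : ℂ => ζ * e) (𝓝 0) (𝓝 0) := by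
        have := (continuous_const_mul ζ).tendsto 0
        rwa [mul_zero] at this
      exact this himg
    have hex : ∀ᶠ e in 𝓝[≠] (0 : ℂ), (e ∈ u '' ({z | F z = F a + g a * u z ^ n} ∩ U) ∧
        ζ * e ∈ u '' ({z | F z = F a + g a * u z ^ n} ∩ U)) ∧ e ≠ 0 :=
      ((Filter.Eventually.and himg himg2).filter_mono nhdsWithin_le_nhds).and self_mem_nhdsWithin
    obtain ⟨e, ⟨⟨z1, ⟨h1, h1U⟩, rfl⟩, ⟨z2, ⟨h2, h2U⟩, h3⟩⟩, he⟩ := hex.exists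
    have : F z1 = F z2 := by
      rw [show F z1 = F a + g a * u z1 ^ n from h1, show F z2 = F a + g a * u z2 ^ n from h2, h3,
        mul_pow ζ, hprim.pow_eq_one, one_mul]
    have h12 := hinj h1U h2U this
    rw [← h12] at h3
    have : ζ = 1 := by
      have h4 : (ζ - 1) * u z1 = 0 := by rw [sub_mul, one_mul, ← h3, sub_self]
      exact sub_eq_zero.mp ((mul_eq_zero.mp h4).resolve_right he)
    exact hprim.ne_one hn1 this
  · have hn1 : n = 1 := by omega
    have h1 : HasDerivAt (fun z => F a + (z - a) ^ n * g z) (g a) a := by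
      have h2 := (((hasDerivAt_id a).sub_const a).mul hg.differentiableAt.hasDerivAt).const_add
        (F a)
      rw [hn1]
      simp only [pow_one]
      refine h2.congr_deriv ?_
      simp
    rw [hF'.deriv_eq, h1.deriv]
    exact hga

/-- The Schwarz–Pick inequality at the origin. -/
theorem norm_deriv_zero_le {χ : ℂ → ℂ} (hd : DifferentiableOn ℂ χ (ball 0 1))
    (hb : ∀ z ∈ ball (0 : ℂ) 1, ‖χ z‖ ≤ 1) : ‖deriv χ 0‖ ≤ 1 - ‖χ 0‖ ^ 2 := by
  have h0 : (0 : ℂ) ∈ ball (0 : ℂ) 1 := by simp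
  have hda : DifferentiableAt ℂ χ 0 := hd.differentiableAt (isOpen_ball.mem_nhds h0)
  rcases (hb 0 h0).lt_or_eq with hlt | heq
  · set b := χ 0
    have hden : ∀ z ∈ ball (0 : ℂ) 1, 1 - (starRingEnd ℂ) b * χ z ≠ 0 := by
      intro z hz h
      have h1 : (starRingEnd ℂ) b * χ z = 1 := (sub_eq_zero.mp h).symm
      have h2 : ‖(starRingEnd ℂ) b * χ z‖ = 1 := by rw [h1, norm_one]
      rw [norm_mul, RCLike.norm_conj] at h2
      nlinarith [hb z hz, norm_nonneg b, norm_nonneg (χ z)]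
    -- Composing with the disk automorphism that sends χ(0) to 0 reduces the claim to the ordinary
    -- Schwarz lemma.
    set h : ℂ → ℂ := fun z => (χ z - b) / (1 - (starRingEnd ℂ) b * χ z)
    have hh0 : h 0 = 0 := by simp [h, b]
    have hhd : DifferentiableOn ℂ h (ball 0 1) :=
      (hd.sub_const b).div ((differentiableOn_const _).sub (hd.const_mul _)) hden
    have hmaps : MapsTo h (ball 0 1) (closedBall (h 0) 1) := by
      intro z hz
      rw [hh0, mem_closedBall_zero_iff, norm_div, div_le_one (norm_pos_iff.mpr (hden z hz))]
      have hsq : ‖χ z - b‖ ^ 2 ≤ ‖1 - (starRingEnd ℂ) b * χ z‖ ^ 2 := by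
        have h1 := hb z hz
        have e1 : ‖1 - (starRingEnd ℂ) b * χ z‖ ^ 2 - ‖χ z - b‖ ^ 2
            = (1 - ‖b‖ ^ 2) * (1 - ‖χ z‖ ^ 2) := by
          simp only [Complex.sq_norm, Complex.normSq_apply]
          simp
          ring
        have : 0 ≤ (1 - ‖b‖ ^ 2) * (1 - ‖χ z‖ ^ 2) := by
          apply mul_nonneg <;> nlinarith [norm_nonneg b, norm_nonneg (χ z)]
        linarith
      exact (sq_le_sq₀ (norm_nonneg _) (norm_nonneg _)).mp hsq
    have hS := norm_deriv_le_div_of_mapsTo_ball hhd hmaps one_pos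
    have hderiv : HasDerivAt h (deriv χ 0 / (1 - ‖b‖ ^ 2 : ℝ)) 0 := by
      have hc : (starRingEnd ℂ) b * b = ((‖b‖ ^ 2 : ℝ) : ℂ) := by
        rw [mul_comm, Complex.mul_conj, Complex.normSq_eq_norm_sq]
      have hne : (1 - (starRingEnd ℂ) b * χ 0) ≠ 0 := hden 0 h0
      have h1 := (hda.hasDerivAt.sub_const b).div
        ((hda.hasDerivAt.const_mul ((starRingEnd ℂ) b)).const_sub 1) hne
      refine h1.congr_deriv ?_
      change (deriv χ 0 * (1 - (starRingEnd ℂ) b * b) - (b - b) * _) /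
        (1 - (starRingEnd ℂ) b * b) ^ 2 = _
      change 1 - (starRingEnd ℂ) b * b ≠ 0 at hne
      rw [hc] at hne ⊢
      push_cast at hne ⊢
      field_simp
      ring
    have hpos : 0 < 1 - ‖b‖ ^ 2 := by nlinarith [norm_nonneg b]
    rw [hderiv.deriv, norm_div, Complex.norm_real, Real.norm_of_nonneg hpos.le, div_one,
      div_le_one hpos] at hS
    exact hS
  · have hmax : IsLocalMax (norm ∘ χ) 0 := by
      filter_upwards [isOpen_ball.mem_nhds h0] with z hz
      simpa [heq] using hb z hz
    have hconst := eventually_eq_of_isLocalMax_norm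
      (hd.eventually_differentiableAt (isOpen_ball.mem_nhds h0)) hmax
    have : deriv χ 0 = 0 := by
      rw [Filter.EventuallyEq.deriv_eq (f := fun _ => χ 0) hconst]; simp
    rw [this, heq]; simp

/-- Schwarz's lemma for a function with a double zero at the origin. -/
theorem norm_le_one_of_norm_sq_mul_le_one {ψ : ℂ → ℂ} (hd : DifferentiableOn ℂ ψ (ball 0 1))
    (hb : ∀ z ∈ ball (0 : ℂ) 1, ‖z ^ 2 * ψ z‖ ≤ 1) {z : ℂ} (hz : z ∈ ball (0 : ℂ) 1) :
    ‖ψ z‖ ≤ 1 := by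
  have hz1 : ‖z‖ < 1 := by simpa using hz
  -- The maximum principle on the circle of radius r gives 1/r²; then r tends to 1.
  have key : ∀ r : ℝ, ‖z‖ < r → r < 1 → ‖ψ z‖ ≤ 1 / r ^ 2 := by
    intro r hzr hr1
    have hr0 : 0 < r := (norm_nonneg z).trans_lt hzr
    have hsub : closure (ball (0 : ℂ) r) ⊆ ball 0 1 :=
      closure_ball_subset_closedBall.trans (closedBall_subset_ball hr1)
    refine norm_le_of_forall_mem_frontier_norm_le (U := ball 0 r) isBounded_ball
      (hd.mono hsub).diffContOnCl (fun w hw => ?_) (subset_closure (by simpa using hzr))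
    rw [frontier_ball _ hr0.ne', mem_sphere_zero_iff_norm] at hw
    have := hb w (by simp [hw, hr1])
    rw [norm_mul, norm_pow, hw] at this
    rw [le_div_iff₀ (by positivity)]
    linarith
  have hlim : Tendsto (fun r : ℝ => 1 / r ^ 2) (𝓝[<] 1) (𝓝 1) := by
    have : ContinuousAt (fun r : ℝ => 1 / r ^ 2) 1 := by
      apply ContinuousAt.div continuousAt_const (by fun_prop) (by norm_num)
    have h2 := this.tendsto
    norm_num at h2
    simpa using h2.mono_left nhdsWithin_le_nhds
  refine ge_of_tendsto hlim ?_
  filter_upwards [Ioo_mem_nhdsLT hz1] with r hr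
  exact key r hr.1 hr.2

/-- Local inverses of analytic functions. -/
theorem exists_local_inverse {F : ℂ → ℂ} {a : ℂ} (hF : AnalyticAt ℂ F a) (h : deriv F a ≠ 0) :
    ∃ r : ℂ → ℂ, AnalyticAt ℂ r (F a) ∧ r (F a) = a ∧ (∀ᶠ x in 𝓝 (F a), F (r x) = x) ∧
      HasDerivAt r (deriv F a)⁻¹ (F a) :=
  ⟨_, hF.analyticAt_localInverse h, HasStrictFDerivAt.localInverse_apply_image ..,
    HasStrictDerivAt.eventually_right_inverse ..,
    (HasStrictDerivAt.to_localInverse hF.hasStrictDerivAt h).hasDerivAt⟩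

/-! ### The function H(s)/s with its simple pole at the origin. -/

/-- The finite values omitted by `s ↦ H s / s` on the unit disk. -/
def omitted (H : ℂ → ℂ) : Set ℂ := {x | ∀ s ∈ ball (0 : ℂ) 1, H s ≠ x * s}

section Polar

variable {H : ℂ → ℂ}

theorem hasDerivAt_div_self (hH : DifferentiableOn ℂ H (ball 0 1)) {σ : ℂ}
    (hσ : σ ∈ ball (0 : ℂ) 1) (h0 : σ ≠ 0) :
    HasDerivAt (fun s => H s / s) (-(H σ - σ * deriv H σ) / σ ^ 2) σ := by
  have h1 := (hH.differentiableAt (isOpen_ball.mem_nhds hσ)).hasDerivAt.div (hasDerivAt_id σ) h0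
  refine h1.congr_deriv ?_
  simp only [id]
  ring

theorem analyticAt_div_self (hH : DifferentiableOn ℂ H (ball 0 1)) {σ : ℂ}
    (hσ : σ ∈ ball (0 : ℂ) 1) (h0 : σ ≠ 0) : AnalyticAt ℂ (fun s => H s / s) σ :=
  (hH.analyticAt (isOpen_ball.mem_nhds hσ)).div analyticAt_id h0

/-- Near a value taken at `σ`, all values are taken near `σ`. -/
theorem eventually_exists_preimage (hH : DifferentiableOn ℂ H (ball 0 1)) {σ : ℂ}
    (hσ : σ ∈ ball (0 : ℂ) 1) (h0 : σ ≠ 0) (hk : H σ - σ * deriv H σ ≠ 0) {U : Set ℂ}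
    (hU : U ∈ 𝓝 σ) :
    ∀ᶠ y in 𝓝 (H σ / σ), ∃ t ∈ U, t ∈ ball (0 : ℂ) 1 ∧ t ≠ 0 ∧ H t = y * t := by
  have hd := hasDerivAt_div_self hH hσ h0
  have hs := (analyticAt_div_self hH hσ h0).hasStrictDerivAt
  rw [hd.deriv] at hs
  have hmap := hs.map_nhds_eq (div_ne_zero (neg_ne_zero.mpr hk) (pow_ne_zero 2 h0))
  rw [← hmap]
  have hV : U ∩ ball (0 : ℂ) 1 ∩ {0}ᶜ ∈ 𝓝 σ :=
    inter_mem (inter_mem hU (isOpen_ball.mem_nhds hσ)) (isOpen_compl_singleton.mem_nhds h0)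
  rw [eventually_map]
  filter_upwards [hV] with t ht
  have ht0 : t ≠ 0 := ht.2
  exact ⟨t, ht.1.1, ht.1.2, ht0, by field_simp⟩

/-- All large values are taken near the origin. -/
theorem exists_preimage_of_large (hH : DifferentiableOn ℂ H (ball 0 1)) (hH0 : H 0 ≠ 0) {U : Set ℂ}
    (hU : U ∈ 𝓝 0) :
    ∃ R : ℝ, ∀ y : ℂ, R < ‖y‖ → ∃ t ∈ U, t ∈ ball (0 : ℂ) 1 ∧ t ≠ 0 ∧ H t = y * t := by
  have hb : (0 : ℂ) ∈ ball (0 : ℂ) 1 := by simp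
  have hHan := hH.analyticAt (isOpen_ball.mem_nhds hb)
  have hd : HasDerivAt (fun s => s / H s) (H 0)⁻¹ 0 := by
    refine ((hasDerivAt_id (0 : ℂ)).div hHan.differentiableAt.hasDerivAt hH0).congr_deriv ?_
    simp only [id]
    field_simp
    ring
  have han : AnalyticAt ℂ (fun s => s / H s) 0 := analyticAt_id.div hHan hH0
  have hs := han.hasStrictDerivAt
  rw [hd.deriv] at hs
  have hmap := hs.map_nhds_eq (inv_ne_zero hH0)
  simp only [zero_div] at hmap
  have hV : U ∩ ball (0 : ℂ) 1 ∩ {s | H s ≠ 0} ∈ 𝓝 (0 : ℂ) :=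
    inter_mem (inter_mem hU (isOpen_ball.mem_nhds hb)) (hHan.continuousAt.eventually_ne hH0)
  have himg : (fun s => s / H s) '' (U ∩ ball (0 : ℂ) 1 ∩ {s | H s ≠ 0}) ∈ 𝓝 (0 : ℂ) := by
    rw [← hmap]; exact image_mem_map hV
  obtain ⟨ε, hε, hsub⟩ := Metric.mem_nhds_iff.mp himg
  refine ⟨1 / ε, fun y hy => ?_⟩
  have hy0 : 0 < ‖y‖ := (by positivity : 0 < 1 / ε).trans hy
  have hyn : y ≠ 0 := norm_pos_iff.mp hy0
  have : y⁻¹ ∈ ball (0 : ℂ) ε := by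
    rw [mem_ball_zero_iff, norm_inv]
    rw [div_lt_iff₀ hε] at hy
    rw [inv_lt_iff_one_lt_mul₀ hy0]
    linarith
  obtain ⟨t, ht, hty⟩ := hsub this
  have hHt : H t ≠ 0 := ht.2
  refine ⟨t, ht.1.1, ht.1.2, ?_, ?_⟩
  · rintro rfl
    simp at hty
    exact hyn hty.symm
  · simp only at hty
    rw [div_eq_iff hHt] at hty
    have := congrArg (y * ·) hty
    simp only [mul_inv_cancel_left₀ hyn] at this
    exact this.symm

/-- Up to the factor -1/s² this is the derivative of the injective function H(s)/s; at s = 0 it is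
H(0). The cross-multiplied form of injectivity treats the pole on the same footing as the other
points. -/
theorem sub_mul_deriv_ne_zero (hH : DifferentiableOn ℂ H (ball 0 1)) (hH0 : H 0 ≠ 0)
    (hinj : ∀ s ∈ ball (0 : ℂ) 1, ∀ t ∈ ball (0 : ℂ) 1, H s * t = H t * s → s = t)
    {σ : ℂ} (hσ : σ ∈ ball (0 : ℂ) 1) : H σ - σ * deriv H σ ≠ 0 := by
  rcases eq_or_ne σ 0 with rfl | h0
  · simpa using hH0
  · have hU : ball (0 : ℂ) 1 ∩ {0}ᶜ ∈ 𝓝 σ :=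
      inter_mem (isOpen_ball.mem_nhds hσ) (isOpen_compl_singleton.mem_nhds h0)
    have := deriv_ne_zero_of_injOn (analyticAt_div_self hH hσ h0) hU (by
      intro s hs t ht hst
      have hs0 : s ≠ 0 := hs.2
      have ht0 : t ≠ 0 := ht.2
      simp only at hst
      rw [div_eq_div_iff hs0 ht0] at hst
      exact hinj s hs.1 t ht.1 hst)
    rw [(hasDerivAt_div_self hH hσ h0).deriv] at this
    intro h
    simp [h] at this

/-- Along a sequence tending to the unit circle, the values cluster at an omitted value. -/
theorem exists_omitted_clusterPt (hH : DifferentiableOn ℂ H (ball 0 1)) (hH0 : H 0 ≠ 0)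
    (hinj : ∀ s ∈ ball (0 : ℂ) 1, ∀ t ∈ ball (0 : ℂ) 1, H s * t = H t * s → s = t)
    {u : ℕ → ℂ} (hu : ∀ n, u n ∈ ball (0 : ℂ) 1)
    (hlim : Tendsto (fun n => ‖u n‖) atTop (𝓝 1)) :
    ∃ x ∈ omitted H, ∃ φ : ℕ → ℕ, StrictMono φ ∧
      Tendsto (fun n => H (u (φ n)) / u (φ n)) atTop (𝓝 x) := by
  obtain ⟨R, hR⟩ := exists_preimage_of_large hH hH0 (ball_mem_nhds (0 : ℂ) one_half_pos)
  have hlarge : ∀ᶠ n in atTop, 1 / 2 < ‖u n‖ := hlim.eventually (lt_mem_nhds (by norm_num))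
  -- Large values are already taken in the disk of radius 1/2, so by injectivity they cannot be
  -- taken near the unit circle.
  have hbd : ∀ᶠ n in atTop, H (u n) / u n ∈ closedBall (0 : ℂ) R := by
    filter_upwards [hlarge] with n hn
    rw [mem_closedBall_zero_iff]
    by_contra! hcon
    obtain ⟨t, ht, htb, ht0, hteq⟩ := hR _ hcon
    have hun : u n ≠ 0 := norm_pos_iff.mp (by linarith)
    have : u n = t := hinj _ (hu n) _ htb (by rw [hteq]; field_simp)
    rw [mem_ball_zero_iff, ← this] at ht
    linarith
  obtain ⟨x, -, φ, hφ, hx⟩ := (isCompact_closedBall (0 : ℂ) R).tendsto_subseq' hbd.frequently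
  refine ⟨x, ?_, φ, hφ, hx⟩
  intro σ hσ hσx
  have hσ0 : σ ≠ 0 := by
    rintro rfl
    simp at hσx
    exact hH0 hσx
  have hσ1 : ‖σ‖ < 1 := by simpa using hσ
  have hx' : x = H σ / σ := by rw [hσx]; field_simp
  obtain ⟨ρ, hρ, hρ1⟩ := exists_between hσ1
  -- If the limit were a value at σ, nearby values would be taken in |t| < ρ < 1, against
  -- injectivity and |u n| → 1.
  have hpre := eventually_exists_preimage hH hσ hσ0 (sub_mul_deriv_ne_zero hH hH0 hinj hσ)
    (isOpen_ball.mem_nhds (by simpa using hρ) : ball (0 : ℂ) ρ ∈ 𝓝 σ)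
  rw [← hx'] at hpre
  have hev := (hx.eventually hpre).and ((hlim.comp hφ.tendsto_atTop).eventually (lt_mem_nhds hρ1))
  obtain ⟨n, ⟨t, ht, htb, ht0, hteq⟩, hn⟩ := hev.exists
  simp only [Function.comp] at hteq hn
  have hun : u (φ n) ≠ 0 := norm_pos_iff.mp (by linarith [norm_nonneg σ])
  have : u (φ n) = t := hinj _ (hu _) _ htb (by rw [hteq]; field_simp)
  rw [mem_ball_zero_iff, ← this] at ht
  linarith

end Polar

/-! ### Necessity: a convex complement forces Re `curvature` ≥ 0. -/

/-- Convexity of the omitted set makes the sublevel sets of the inverse convex: a mean of two values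
`H s₁ / s₁`, `H s₂ / s₂` with `‖s₁‖ = ‖s₂‖ = ‖s‖` is never a value `H σ / σ` with `‖σ‖ < ‖s‖`. -/
theorem mean_ne_value {H : ℂ → ℂ} (hH : DifferentiableOn ℂ H (ball 0 1)) (hH0 : H 0 ≠ 0)
    (hinj : ∀ s ∈ ball (0 : ℂ) 1, ∀ t ∈ ball (0 : ℂ) 1, H s * t = H t * s → s = t)
    (hconv : Convex ℝ (omitted H)) {ξ : ℂ} (hξ : ‖ξ‖ = 1) {s₀ τ₀ : ℂ}
    (hs₀ : s₀ ∈ ball (0 : ℂ) 1) (hτ₀ : ‖τ₀‖ < 1) :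
    (H (ξ * s₀) / ξ + H (ξ⁻¹ * s₀) * ξ) / 2 * τ₀ ≠ H (τ₀ * s₀) := by
  intro hcon
  have hξ0 : ξ ≠ 0 := norm_pos_iff.mp (by rw [hξ]; exact one_pos)
  have hb : (0 : ℂ) ∈ ball (0 : ℂ) 1 := by simp
  have hmem : ∀ {s : ℂ}, s ∈ ball (0 : ℂ) 1 ↔ ‖s‖ < 1 := mem_ball_zero_iff
  have hm1 : ∀ s ∈ ball (0 : ℂ) 1, ξ * s ∈ ball (0 : ℂ) 1 := fun s hs => by
    rw [hmem] at hs ⊢; rwa [norm_mul, hξ, one_mul]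
  have hm2 : ∀ s ∈ ball (0 : ℂ) 1, ξ⁻¹ * s ∈ ball (0 : ℂ) 1 := fun s hs => by
    rw [hmem] at hs ⊢; rwa [norm_mul, norm_inv, hξ, inv_one, one_mul]
  have hm3 : ∀ τ s : ℂ, ‖τ‖ < 1 → ‖s‖ ≤ 1 → τ * s ∈ ball (0 : ℂ) 1 := fun τ s hτ hs => by
    rw [hmem, norm_mul]; nlinarith [norm_nonneg τ, norm_nonneg s]
  set J : ℂ → ℂ := fun s => (H (ξ * s) / ξ + H (ξ⁻¹ * s) * ξ) / 2 with hJ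
  have hJd : DifferentiableOn ℂ J (ball 0 1) := by
    refine DifferentiableOn.div_const (DifferentiableOn.add (DifferentiableOn.div_const ?_ _)
      (DifferentiableOn.mul_const ?_ _)) _
    · exact hH.comp (by fun_prop) hm1
    · exact hH.comp (by fun_prop) hm2
  -- J(s)/s is the mean of G(ξs) and G(ξ⁻¹s), and τ is the ratio σ/s for a preimage σ of that mean.
  -- The form without division keeps s = 0 meaningful, where τ would have to satisfy (ξ + ξ⁻¹)τ/2 =
  -- 1.
  set S : Set (ℂ × ℂ) := {q | q.1 ∈ ball (0 : ℂ) 1 ∧ ‖q.2‖ < 1 ∧ J q.1 * q.2 = H (q.2 * q.1)}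
    with hS
  have hS0 : ∀ q ∈ S, q.1 ≠ 0 := by
    rintro ⟨s, τ⟩ ⟨-, hτ, heq⟩ h
    simp only at h heq hτ
    subst h
    simp only [hJ, mul_zero] at heq
    have h1 : (1 / ξ + ξ) / 2 * τ = 1 := by
      apply mul_left_cancel₀ hH0
      linear_combination heq
    have h2 : ‖(1 / ξ + ξ) / 2‖ ≤ 1 := by
      rw [norm_div]
      have := norm_add_le (1 / ξ) ξ
      rw [norm_div, hξ] at this
      norm_num at this ⊢
      linarith
    have h3 := congrArg norm h1
    rw [norm_mul, norm_one] at h3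
    nlinarith [norm_nonneg τ]
  have hτ0 : ∀ q ∈ S, q.2 ≠ 0 := by
    rintro ⟨s, τ⟩ ⟨-, hτ, heq⟩ h
    simp only at h heq hτ
    subst h
    simp at heq
    exact hH0 heq.symm
  -- minimise the second coordinate over `S`
  have hne : ((fun q : ℂ × ℂ => ‖q.2‖) '' S).Nonempty := ⟨_, ⟨(s₀, τ₀), ⟨hs₀, hτ₀, hcon⟩, rfl⟩⟩
  have hbdd : BddBelow ((fun q : ℂ × ℂ => ‖q.2‖) '' S) :=
    ⟨0, by rintro _ ⟨q, -, rfl⟩; exact norm_nonneg _⟩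
  obtain ⟨v, -, hvlim, hv⟩ := exists_seq_tendsto_sInf hne hbdd
  set μ := sInf ((fun q : ℂ × ℂ => ‖q.2‖) '' S) with hμ
  have hμ1 : μ < 1 := (csInf_le hbdd ⟨(s₀, τ₀), ⟨hs₀, hτ₀, hcon⟩, rfl⟩).trans_lt hτ₀
  have hμle : ∀ q ∈ S, μ ≤ ‖q.2‖ := fun q hq => csInf_le hbdd ⟨q, hq, rfl⟩
  choose q hqS hqv using hv
  have hqc : ∀ n, q n ∈ closedBall (0 : ℂ) 1 ×ˢ closedBall (0 : ℂ) 1 := fun n =>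
    ⟨ball_subset_closedBall (hqS n).1, by simpa using (hqS n).2.1.le⟩
  obtain ⟨⟨s, τ⟩, hst, φ, hφ, hlim⟩ :=
    ((isCompact_closedBall (0 : ℂ) 1).prod (isCompact_closedBall (0 : ℂ) 1)).tendsto_subseq hqc
  have hlim1 : Tendsto (fun n => (q (φ n)).1) atTop (𝓝 s) := (continuous_fst.tendsto _).comp hlim
  have hlim2 : Tendsto (fun n => (q (φ n)).2) atTop (𝓝 τ) := (continuous_snd.tendsto _).comp hlim
  have hτμ : ‖τ‖ = μ := by
    refine tendsto_nhds_unique hlim2.norm ?_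
    have := hvlim.comp hφ.tendsto_atTop
    refine this.congr fun n => ?_
    simp only [Function.comp, ← hqv]
  have hτ1 : ‖τ‖ < 1 := hτμ ▸ hμ1
  have hs1 : ‖s‖ ≤ 1 := by simpa using hst.1
  have hRlim : Tendsto (fun n => H ((q (φ n)).2 * (q (φ n)).1)) atTop (𝓝 (H (τ * s))) :=
    ((hH.differentiableAt (isOpen_ball.mem_nhds (hm3 τ s hτ1 hs1))).continuousAt.tendsto).comp
      (hlim2.mul hlim1)
  rcases hs1.lt_or_eq with hlt | heq
  · have hsb : s ∈ ball (0 : ℂ) 1 := hmem.mpr hlt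
    have hJc := (hJd.differentiableAt (isOpen_ball.mem_nhds hsb)).continuousAt.tendsto
    have hLlim := (hJc.comp hlim1).mul hlim2
    have hstS : (s, τ) ∈ S := by
      refine ⟨hsb, hτ1, tendsto_nhds_unique hLlim (hRlim.congr fun n => ?_)⟩
      exact (hqS (φ n)).2.2.symm
    have hs0 : s ≠ 0 := hS0 _ hstS
    have hτ0' : τ ≠ 0 := hτ0 _ hstS
    have hJs : J s * τ = H (τ * s) := hstS.2.2
    have hσb : τ * s ∈ ball (0 : ℂ) 1 := hm3 τ s hτ1 hs1
    have hσ0 : τ * s ≠ 0 := mul_ne_zero hτ0' hs0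
    have hk := sub_mul_deriv_ne_zero hH hH0 hinj hσb
    have hderiv : deriv (fun s => H s / s) (τ * s) ≠ 0 := by
      rw [(hasDerivAt_div_self hH hσb hσ0).deriv]
      exact div_ne_zero (neg_ne_zero.mpr hk) (pow_ne_zero 2 hσ0)
    obtain ⟨r, hr, hrx, hrev, -⟩ := exists_local_inverse (analyticAt_div_self hH hσb hσ0) hderiv
    have hB : J s / s = H (τ * s) / (τ * s) := by rw [← hJs]; field_simp
    have hBan : AnalyticAt ℂ (fun w => J w / w) s :=
      (hJd.analyticAt (isOpen_ball.mem_nhds hsb)).div analyticAt_id hs0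
    rw [← hB] at hr hrx hrev
    have hρan : AnalyticAt ℂ (fun w => r (J w / w)) s :=
      AnalyticAt.fun_comp (f := fun w => J w / w) hr hBan
    have hQan : AnalyticAt ℂ (fun w => r (J w / w) / w) s := hρan.div analyticAt_id hs0
    -- Interior minimum: Q is a holomorphic branch of the ratio τ, and its modulus has a nonzero
    -- local minimum at s, so it is constant. The identity theorem carries the relation to s = 0,
    -- which `hS0` forbids.
    set Q : ℂ → ℂ := fun w => r (J w / w) / w with hQ
    have hQs : Q s = τ := by simp only [hQ, hrx]; field_simp
    have hev : ∀ᶠ w in 𝓝 s, (w, Q w) ∈ S := by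
      have e1 : ∀ᶠ w in 𝓝 s, ‖Q w‖ < 1 :=
        hQan.continuousAt.norm.eventually (gt_mem_nhds (by simpa only [hQs] using hτ1))
      have e2 : ∀ᶠ w in 𝓝 s, H (r (J w / w)) / (r (J w / w)) = J w / w :=
        hBan.continuousAt.eventually hrev
      have e3 : ∀ᶠ w in 𝓝 s, r (J w / w) ≠ 0 :=
        hρan.continuousAt.eventually_ne (by simp only [hrx]; exact hσ0)
      have e4 : ∀ᶠ w in 𝓝 s, w ≠ 0 := continuousAt_id.eventually_ne hs0
      filter_upwards [e1, e2, e3, e4, isOpen_ball.mem_nhds hsb] with w h1 h2 h3 h4 h5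
      refine ⟨h5, h1, ?_⟩
      have : Q w * w = r (J w / w) := by simp only [hQ]; field_simp
      simp only [this]
      rw [div_eq_div_iff h3 h4] at h2
      simp only [hQ]
      field_simp
      linear_combination -h2
    have hmin : IsLocalMin (norm ∘ Q) s := by
      filter_upwards [hev] with w hw
      simp only [Function.comp, hQs, hτμ]
      exact hμle _ hw
    have hconst : ∀ᶠ w in 𝓝 s, Q w = τ := by
      rcases eventually_eq_or_eq_zero_of_isLocalMin_norm
        (hQan.eventually_analyticAt.mono fun _ h => h.differentiableAt) hmin with h | h
      · simpa only [hQs] using h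
      · exact absurd (hQs ▸ h) hτ0'
    have hJeq : (fun w => J w * τ) =ᶠ[𝓝 s] fun w => H (τ * w) := by
      filter_upwards [hev, hconst] with w h1 h2
      have := h1.2.2
      simpa only [h2] using this
    have hg1 : AnalyticOnNhd ℂ (fun w => J w * τ) (ball 0 1) :=
      (hJd.mul_const τ).analyticOnNhd isOpen_ball
    have hg2 : AnalyticOnNhd ℂ (fun w => H (τ * w)) (ball 0 1) :=
      (hH.comp (f := fun w => τ * w) (by fun_prop)
        fun w hw => hm3 τ w hτ1 (hmem.mp hw).le).analyticOnNhd isOpen_ball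
    have h00 := hg1.eqOn_of_preconnected_of_eventuallyEq hg2
      (convex_ball (0 : ℂ) 1).isPreconnected hsb hJeq hb
    exact hS0 (0, τ) ⟨hb, hτ1, h00⟩ rfl
  -- Boundary minimum: the two values cluster at omitted points x and y. Their midpoint is omitted
  -- by convexity, yet the limit of the relation makes it the value at τs, inside the disk.
  · have hnorm : Tendsto (fun n => ‖(q (φ n)).1‖) atTop (𝓝 1) := heq ▸ hlim1.norm
    obtain ⟨x, hx, φ₁, hφ₁, hxlim⟩ := exists_omitted_clusterPt hH hH0 hinj
      (u := fun n => ξ * (q (φ n)).1) (fun n => hm1 _ (hqS _).1) (by simpa [hξ] using hnorm)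
    obtain ⟨y, hy, φ₂, hφ₂, hylim⟩ := exists_omitted_clusterPt hH hH0 hinj
      (u := fun n => ξ⁻¹ * (q (φ (φ₁ n))).1) (fun n => hm2 _ (hqS _).1)
      (by simpa [hξ, Function.comp_def] using hnorm.comp hφ₁.tendsto_atTop)
    have hsub : StrictMono (fun n => φ₁ (φ₂ n)) := hφ₁.comp hφ₂
    have hlims := ((hxlim.comp hφ₂.tendsto_atTop).add hylim).div_const 2
    have hL := (hlims.mul (hlim1.comp hsub.tendsto_atTop)).mul (hlim2.comp hsub.tendsto_atTop)
    have hlim' := tendsto_nhds_unique hL ((hRlim.comp hsub.tendsto_atTop).congr fun n => by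
      have h1 := (hqS (φ (φ₁ (φ₂ n)))).2.2
      have h2 := hS0 _ (hqS (φ (φ₁ (φ₂ n))))
      simp only [Function.comp]
      rw [← h1]
      simp only [hJ]
      field_simp)
    have hmid : (x + y) / 2 ∈ omitted H := by
      have := hconv hx hy (a := 1 / 2) (b := 1 / 2) (by norm_num) (by norm_num) (by norm_num)
      convert! this using 1
      simp only [Complex.real_smul]
      push_cast
      ring
    refine hmid (τ * s) (hm3 τ s hτ1 hs1) ?_
    rw [← hlim']
    ring

/-- The function `1 + s² H'' / (H - s H')`, i.e. `-(1 + s G'' / G')` for `G s = H s / s`. -/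
noncomputable def curvature (H : ℂ → ℂ) (s : ℂ) : ℂ := 1 + s ^ 2 * deriv (deriv H) s / (H s - s * deriv H s)

theorem hasDerivAt_sub_mul_deriv {H : ℂ → ℂ} (hH : DifferentiableOn ℂ H (ball 0 1)) {s : ℂ}
    (hs : s ∈ ball (0 : ℂ) 1) :
    HasDerivAt (fun s => H s - s * deriv H s) (-(s * deriv (deriv H) s)) s := by
  have h1 := (hH.analyticAt (isOpen_ball.mem_nhds hs))
  refine (h1.differentiableAt.hasDerivAt.sub
    ((hasDerivAt_id s).mul h1.deriv.differentiableAt.hasDerivAt)).congr_deriv ?_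
  simp only [id]
  ring

/-- The second derivative of `α ↦ G (s exp (i α))` at `α = 0`, where `G s = H s / s`. -/
theorem iteratedDeriv_two_circle {H : ℂ → ℂ} (hH : DifferentiableOn ℂ H (ball 0 1)) {s : ℂ}
    (hs : s ∈ ball (0 : ℂ) 1) (hs0 : s ≠ 0) (hk : H s - s * deriv H s ≠ 0) :
    iteratedDeriv 2 (fun α : ℂ => H (s * exp (α * I)) / (s * exp (α * I))) 0
      = -((H s - s * deriv H s) / s * curvature H s) := by
  have hw : ∀ α : ℂ, HasDerivAt (fun α => s * exp (α * I)) (I * (s * exp (α * I))) α := by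
    intro α
    refine ((((hasDerivAt_id α).mul_const I).cexp).const_mul s).congr_deriv ?_
    simp only [id]
    ring
  have hmem : ∀ᶠ α in 𝓝 (0 : ℂ), s * exp (α * I) ∈ ball (0 : ℂ) 1 := by
    have hc : ContinuousAt (fun α => s * exp (α * I)) (0 : ℂ) := (hw 0).continuousAt
    exact hc.eventually (isOpen_ball.mem_nhds (by simpa using hs))
  have hd1 : deriv (fun α : ℂ => H (s * exp (α * I)) / (s * exp (α * I))) =ᶠ[𝓝 0]
      fun α => -I * ((H (s * exp (α * I)) - s * exp (α * I) * deriv H (s * exp (α * I))) /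
        (s * exp (α * I))) := by
    filter_upwards [hmem] with α hα
    have hne : s * exp (α * I) ≠ 0 := mul_ne_zero hs0 (exp_ne_zero _)
    have := (hasDerivAt_div_self hH hα hne).comp α (hw α)
    rw [show (fun α : ℂ => H (s * exp (α * I)) / (s * exp (α * I))) =
      (fun s => H s / s) ∘ fun α => s * exp (α * I) from rfl, this.deriv]
    field_simp
  rw [iteratedDeriv_succ, iteratedDeriv_one, hd1.deriv_eq]
  have hw0 : s * exp ((0 : ℂ) * I) = s := by simp
  have hk' : HasDerivAt (fun s => -I * ((H s - s * deriv H s) / s))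
      (-I * ((-(s * deriv (deriv H) s) * s - (H s - s * deriv H s)) / s ^ 2))
      (s * exp ((0 : ℂ) * I)) := by
    rw [hw0]
    refine (((hasDerivAt_sub_mul_deriv hH hs).div (hasDerivAt_id s) hs0).const_mul
      (-I)).congr_deriv ?_
    simp only [id]
    ring
  have := hk'.comp (0 : ℂ) (hw 0)
  rw [show (fun α : ℂ => -I * ((H (s * exp (α * I)) - s * exp (α * I) * deriv H (s * exp (α * I))) /
        (s * exp (α * I)))) =
      (fun s => -I * ((H s - s * deriv H s) / s)) ∘ fun α => s * exp (α * I) from rfl, this.deriv,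
      hw0, curvature]
  field_simp
  ring_nf
  rw [I_sq]
  ring

/-- The mean of G(se^{iα}) and G(se^{-iα}) has local preimage s(1 + α²W(α)) with W(0+) = `curvature
H s` / 2. By `mean_ne_value` this preimage has modulus at least |s|, and the α² term of |1 + α²W|² ≥
1 gives the sign. -/
theorem re_curvature_nonneg {H : ℂ → ℂ} (hH : DifferentiableOn ℂ H (ball 0 1)) (hH0 : H 0 ≠ 0)
    (hinj : ∀ s ∈ ball (0 : ℂ) 1, ∀ t ∈ ball (0 : ℂ) 1, H s * t = H t * s → s = t)
    (hconv : Convex ℝ (omitted H)) {s : ℂ} (hs : s ∈ ball (0 : ℂ) 1) :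
    0 ≤ (curvature H s).re := by
  rcases eq_or_ne s 0 with rfl | hs0
  · simp [curvature]
  have hk := sub_mul_deriv_ne_zero hH hH0 hinj hs
  have hG' := hasDerivAt_div_self hH hs hs0
  have hGd : deriv (fun s => H s / s) s ≠ 0 := by
    rw [hG'.deriv]
    exact div_ne_zero (neg_ne_zero.mpr hk) (pow_ne_zero 2 hs0)
  obtain ⟨r, hr, hrx, hrev, hrd⟩ := exists_local_inverse (analyticAt_div_self hH hs hs0) hGd
  rw [hG'.deriv] at hrd
  set x₀ := H s / s with hx₀
  set φ : ℂ → ℂ := fun α => H (s * exp (α * I)) / (s * exp (α * I)) with hφ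
  have hφan : AnalyticAt ℂ φ 0 := by
    have h1 : AnalyticAt ℂ (fun α : ℂ => s * exp (α * I)) 0 := by fun_prop
    have h2 : AnalyticAt ℂ (fun s => H s / s) (s * exp ((0 : ℂ) * I)) := by
      simpa using analyticAt_div_self hH hs hs0
    exact AnalyticAt.fun_comp (f := fun α : ℂ => s * exp (α * I)) h2 h1
  have hφ0 : φ 0 = x₀ := by simp [hφ, hx₀]
  obtain ⟨F, hF, hFeq⟩ := hφan.exists_eq_sum_add_pow_mul 3
  have hφ2 : iteratedDeriv 2 φ 0 = -((H s - s * deriv H s) / s * curvature H s) :=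
    iteratedDeriv_two_circle hH hs hs0 hk
  set c : ℂ := -((H s - s * deriv H s) / s * curvature H s) / 2 with hc
  -- the mean of `φ α` and `φ (-α)`
  set A : ℝ → ℂ := fun α => (φ α + φ (-α)) / 2 with hA
  set E : ℝ → ℂ := fun α => c + α * (F α - F (-α)) / 2 with hE
  have hAE : ∀ α : ℝ, A α = x₀ + (α : ℂ) ^ 2 * E α := by
    intro α
    simp only [hA]
    rw [hFeq α, hFeq (-α)]
    simp only [Finset.sum_range_succ, Finset.sum_range_zero, iteratedDeriv_zero, hφ0, hφ2,
      smul_eq_mul, hE, hc]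
    norm_num
    ring
  have hEc : Tendsto E (𝓝 0) (𝓝 c) := by
    have h1 : Tendsto (fun α : ℝ => F α) (𝓝 0) (𝓝 (F 0)) :=
      hF.continuousAt.tendsto.comp (by simpa using Complex.continuous_ofReal.tendsto 0)
    have h2 : Tendsto (fun α : ℝ => F (-α)) (𝓝 0) (𝓝 (F 0)) :=
      hF.continuousAt.tendsto.comp (by
        have : Continuous fun α : ℝ => -(α : ℂ) := by fun_prop
        simpa using this.tendsto 0)
    have h3 : Tendsto (fun α : ℝ => (α : ℂ)) (𝓝 0) (𝓝 0) := by
      simpa using Complex.continuous_ofReal.tendsto 0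
    simpa using ((h3.mul (h1.sub h2)).div_const 2).const_add c
  have hAc : Tendsto A (𝓝 0) (𝓝 x₀) := by
    have h3 : Tendsto (fun α : ℝ => (α : ℂ) ^ 2) (𝓝 0) (𝓝 0) := by
      have : Continuous fun α : ℝ => (α : ℂ) ^ 2 := by fun_prop
      simpa using this.tendsto 0
    have := (h3.mul hEc).const_add x₀
    rw [zero_mul, add_zero] at this
    exact this.congr fun α => (hAE α).symm
  -- The difference quotient of the local inverse gives an exact factorization of r(A α) - s, with
  -- no remainder term to estimate.
  set q : ℂ → ℂ := dslope r x₀ with hq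
  have hqc : Tendsto (fun α => q (A α)) (𝓝 0) (𝓝 (-(H s - s * deriv H s) / s ^ 2)⁻¹) := by
    have := (continuousAt_dslope_same.mpr hr.differentiableAt).tendsto
    rw [dslope_same, hrd.deriv] at this
    exact this.comp hAc
  have hrA : ∀ α, r (A α) = s * (1 + (α : ℂ) ^ 2 * (E α * q (A α) / s)) := by
    intro α
    have h1 : (A α - x₀) * q (A α) = r (A α) - s := by
      have := sub_smul_dslope r x₀ (A α)
      rwa [hrx, smul_eq_mul] at this
    have h2 : s * (1 + (α : ℂ) ^ 2 * (E α * q (A α) / s)) = s + (α : ℂ) ^ 2 * E α * q (A α) := by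
      generalize E α = e
      generalize q (A α) = d
      field_simp
    rw [h2]
    linear_combination -h1 + q (A α) * hAE α
  set W : ℝ → ℂ := fun α => E α * q (A α) / s with hW
  have hWlim : Tendsto W (𝓝 0) (𝓝 (curvature H s / 2)) := by
    have := (hEc.mul hqc).div_const s
    convert! this using 2
    rw [hc]
    field_simp
  have hineq : ∀ᶠ α : ℝ in 𝓝[≠] 0, 0 ≤ 2 * (W α).re + α ^ 2 * ‖W α‖ ^ 2 := by
    have e1 : ∀ᶠ α in 𝓝 (0 : ℝ), H (r (A α)) / r (A α) = A α := hAc.eventually hrev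
    have e2 : ∀ᶠ α in 𝓝 (0 : ℝ), r (A α) ≠ 0 := by
      have : Tendsto (fun α => r (A α)) (𝓝 0) (𝓝 s) := hrx ▸ hr.continuousAt.tendsto.comp hAc
      exact this.eventually_ne hs0
    filter_upwards [nhdsWithin_le_nhds e1, nhdsWithin_le_nhds e2, self_mem_nhdsWithin]
      with α h1 h2 hα
    have hα0 : α ≠ 0 := hα
    have hge : 1 ≤ ‖1 + (α : ℂ) ^ 2 * W α‖ := by
      by_contra! hlt
      refine mean_ne_value hH hH0 hinj hconv (ξ := exp (α * I)) (norm_exp_ofReal_mul_I α) hs hlt ?_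
      have h3 : (1 + (α : ℂ) ^ 2 * W α) * s = r (A α) := by rw [hrA]; ring
      rw [h3]
      have h4 : H (r (A α)) = A α * r (A α) := (div_eq_iff h2).mp h1
      rw [h4, ← h3]
      simp only [hA, hφ]
      have he := exp_ne_zero ((α : ℂ) * I)
      rw [show (exp (α * I))⁻¹ * s = s * exp (-α * I) by rw [neg_mul, exp_neg]; ring,
        show exp (-(α : ℂ) * I) = (exp (α * I))⁻¹ by rw [neg_mul, exp_neg], mul_comm _ s]
      field_simp
    have hsq : (1 : ℝ) ≤ ‖1 + (α : ℂ) ^ 2 * W α‖ ^ 2 := one_le_pow₀ hge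
    have hexp : ‖1 + (α : ℂ) ^ 2 * W α‖ ^ 2 =
        1 + α ^ 2 * (2 * (W α).re + α ^ 2 * ‖W α‖ ^ 2) := by
      rw [Complex.sq_norm, Complex.sq_norm, Complex.normSq_apply, Complex.normSq_apply]
      rw [← ofReal_pow]
      simp only [add_re, one_re, re_ofReal_mul, add_im, one_im, im_ofReal_mul]
      ring
    have hα2 : 0 < α ^ 2 := by positivity
    rw [hexp] at hsq
    by_contra! hneg
    nlinarith
  have hfin : Tendsto (fun α : ℝ => 2 * (W α).re + α ^ 2 * ‖W α‖ ^ 2) (𝓝[≠] 0)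
      (𝓝 (2 * (curvature H s / 2).re + 0 ^ 2 * ‖curvature H s / 2‖ ^ 2)) := by
    have h1 := (Complex.continuous_re.tendsto _).comp hWlim
    have h2 : Tendsto (fun α : ℝ => α ^ 2) (𝓝 0) (𝓝 (0 ^ 2)) := (continuous_pow 2).tendsto 0
    exact ((h1.const_mul 2).add (h2.mul (hWlim.norm.pow 2))).mono_left nhdsWithin_le_nhds
  have := ge_of_tendsto hfin hineq
  have e : (curvature H s / 2).re = (curvature H s).re / 2 := by
    simp
  rw [e] at this
  linarith

/-! ### Strict convexity of the images of circles. -/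

section Circle

variable {H κ : ℂ → ℂ}

/-- The image of a circle is strictly convex: it lies strictly on one side of each tangent line. -/
theorem re_mul_conj_neg_of_exp (hH : DifferentiableOn ℂ H (ball 0 1))
    (hκ : DifferentiableOn ℂ κ (ball 0 1))
    (hk : ∀ s ∈ ball (0 : ℂ) 1, H s - s * deriv H s = exp (κ s))
    (hN : ∀ s ∈ ball (0 : ℂ) 1, 0 < (1 - s * deriv κ s).re) {s : ℂ}
    (hs : s ∈ ball (0 : ℂ) 1) (hs0 : s ≠ 0) {θ : ℝ} (hθ : θ ∈ Ioo 0 (2 * Real.pi)) :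
    ((H (s * exp (-(θ * I))) / (s * exp (-(θ * I))) - H s / s) *
      (starRingEnd ℂ) (exp (κ s) / s)).re < 0 := by
  -- The circle is run clockwise because the pole reverses orientation: the normal e^κ/w to the
  -- image curve then turns counterclockwise.
  set w : ℝ → ℂ := fun θ => s * exp (-(θ * I)) with hw
  have hwd : ∀ θ : ℝ, HasDerivAt w (-(I * w θ)) θ := by
    intro θ
    have h1 : HasDerivAt (fun θ : ℝ => (θ : ℂ)) 1 θ := Complex.ofRealCLM.hasDerivAt
    refine ((((h1.mul_const I).neg).cexp).const_mul s).congr_deriv ?_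
    simp only [hw]
    simp only [Pi.neg_apply]
    ring
  have hwn : ∀ θ, ‖w θ‖ = ‖s‖ := by
    intro θ
    simp only [hw]
    rw [norm_mul, show -((θ : ℂ) * I) = ((-θ : ℝ) : ℂ) * I by push_cast; ring,
      norm_exp_ofReal_mul_I, mul_one]
  have hwb : ∀ θ, w θ ∈ ball (0 : ℂ) 1 := fun θ => by
    rw [mem_ball_zero_iff, hwn]; simpa using hs
  have hw0 : ∀ θ, w θ ≠ 0 := fun θ => mul_ne_zero hs0 (exp_ne_zero _)
  have hwz : w 0 = s := by simp [hw]
  have hwp : w (2 * Real.pi) = s := by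
    simp only [hw]
    rw [exp_neg]
    push_cast
    rw [exp_two_pi_mul_I, inv_one, mul_one]
  -- the direction of the normal vector
  set Δ : ℝ → ℝ := fun θ => (κ (w θ)).im + θ - (κ s).im with hΔ
  have hκw : ∀ θ : ℝ, HasDerivAt (fun θ => κ (w θ)) (deriv κ (w θ) * -(I * w θ)) θ := fun θ =>
    (hκ.differentiableAt (isOpen_ball.mem_nhds (hwb θ))).hasDerivAt.comp_of_eq θ (hwd θ) rfl
  have hΔd : ∀ θ : ℝ, HasDerivAt Δ (1 - w θ * deriv κ (w θ)).re θ := by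
    intro θ
    have h1 : HasDerivAt (fun θ => (κ (w θ)).im) (deriv κ (w θ) * -(I * w θ)).im θ :=
      Complex.imCLM.hasFDerivAt.comp_hasDerivAt θ (hκw θ)
    refine ((h1.add (hasDerivAt_id θ)).sub_const (κ s).im).congr_deriv ?_
    simp
    ring
  have hΔmono : StrictMono Δ := strictMono_of_deriv_pos fun θ => by
    rw [(hΔd θ).deriv]; exact hN _ (hwb θ)
  have hΔ0 : Δ 0 = 0 := by simp [hΔ, hwz]
  have hΔ2 : Δ (2 * Real.pi) = 2 * Real.pi := by simp [hΔ, hwp]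
  have hΔc : Continuous Δ := continuous_iff_continuousAt.mpr fun θ => (hΔd θ).continuousAt
  obtain ⟨θ₁, hθ₁, hΔ1⟩ : ∃ θ₁ ∈ Icc 0 (2 * Real.pi), Δ θ₁ = Real.pi :=
    intermediate_value_Icc (by positivity) hΔc.continuousOn
      (by rw [hΔ0, hΔ2]; constructor <;> linarith [Real.pi_pos])
  -- The height h along the normal at s has derivative -C sin Δ: it falls until Δ = π, then rises
  -- back to its initial value at 2π.
  set h : ℝ → ℝ := fun θ => (H (w θ) / w θ * (starRingEnd ℂ) (exp (κ s) / s)).re with hh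
  set C : ℝ → ℝ := fun θ => Real.exp ((κ (w θ)).re + (κ s).re) / normSq s with hC
  have hCpos : ∀ θ, 0 < C θ := fun θ => div_pos (Real.exp_pos _) (normSq_pos.mpr hs0)
  have hhd : ∀ θ : ℝ, HasDerivAt h (-(C θ * Real.sin (Δ θ))) θ := by
    intro θ
    have h1 := (hasDerivAt_div_self hH (hwb θ) (hw0 θ)).comp_of_eq θ (hwd θ) rfl
    have h2 : HasDerivAt (fun θ => H (w θ) / w θ)
        (-(H (w θ) - w θ * deriv H (w θ)) / w θ ^ 2 * -(I * w θ)) θ := h1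
    have h3 : HasDerivAt h _ θ := Complex.reCLM.hasFDerivAt.comp_hasDerivAt θ
      (h2.mul_const ((starRingEnd ℂ) (exp (κ s) / s)))
    refine h3.congr_deriv ?_
    rw [hk _ (hwb θ)]
    have e0 : (starRingEnd ℂ) s ≠ 0 := (map_ne_zero _).mpr hs0
    have e1 : -exp (κ (w θ)) / w θ ^ 2 * -(I * w θ) * (starRingEnd ℂ) (exp (κ s) / s) =
        ((normSq s)⁻¹ : ℝ) * (I * exp (κ (w θ) + θ * I + (starRingEnd ℂ) (κ s))) := by
      rw [map_div₀, ← exp_conj, exp_add, exp_add, ofReal_inv, ← mul_conj]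
      have e2 : w θ * exp (θ * I) = s := by
        simp only [hw]
        rw [mul_assoc, ← exp_add]; simp
      have e3 : exp ((θ : ℂ) * I) ≠ 0 := exp_ne_zero _
      have e4 := hw0 θ
      generalize (starRingEnd ℂ) s = s' at *
      rw [← e2]
      field_simp
    simp only [Complex.reCLM_apply]
    rw [e1, re_ofReal_mul, I_mul_re, exp_im]
    simp only [hC, hΔ, add_re, add_im, mul_re, mul_im, ofReal_re, ofReal_im, I_re, I_im, conj_re,
      conj_im]
    ring_nf
  have hhc : Continuous h := continuous_iff_continuousAt.mpr fun θ => (hhd θ).continuousAt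
  have hh0 : h (2 * Real.pi) = h 0 := by simp [hh, hwz, hwp]
  have key : h θ < h 0 := by
    rcases le_total θ θ₁ with hle | hle
    · have hanti : StrictAntiOn h (Icc 0 θ₁) := by
        refine strictAntiOn_of_deriv_neg (convex_Icc _ _) hhc.continuousOn fun x hx => ?_
        rw [interior_Icc] at hx
        rw [(hhd x).deriv, neg_lt_zero]
        refine mul_pos (hCpos x) (Real.sin_pos_of_pos_of_lt_pi ?_ ?_)
        · rw [← hΔ0]; exact hΔmono hx.1
        · rw [← hΔ1]; exact hΔmono hx.2
      exact hanti ⟨le_rfl, hθ₁.1⟩ ⟨hθ.1.le, hle⟩ hθ.1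
    · have hmono : StrictMonoOn h (Icc θ₁ (2 * Real.pi)) := by
        refine strictMonoOn_of_deriv_pos (convex_Icc _ _) hhc.continuousOn fun x hx => ?_
        rw [interior_Icc] at hx
        rw [(hhd x).deriv, neg_pos]
        refine mul_neg_of_pos_of_neg (hCpos x) ?_
        have h1 := hΔmono hx.1
        have h2 := hΔmono hx.2
        rw [hΔ1] at h1
        rw [hΔ2] at h2
        have := Real.sin_neg_of_neg_of_neg_pi_lt (x := Δ x - 2 * Real.pi) (by linarith)
          (by linarith)
        rwa [Real.sin_sub_two_pi] at this
      rw [← hh0]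
      exact hmono ⟨hle, hθ.2.le⟩ ⟨hθ₁.2, le_rfl⟩ hθ.2
  have : h θ - h 0 < 0 := sub_neg.mpr key
  simp only [hh, hwz] at this
  rw [sub_mul, sub_re]
  exact this

/-- Two points on a circle about the origin: the image of one lies strictly on one side of the
tangent line at the image of the other. -/
theorem re_mul_conj_neg (hH : DifferentiableOn ℂ H (ball 0 1))
    (hκ : DifferentiableOn ℂ κ (ball 0 1))
    (hk : ∀ s ∈ ball (0 : ℂ) 1, H s - s * deriv H s = exp (κ s))
    (hN : ∀ s ∈ ball (0 : ℂ) 1, 0 < (1 - s * deriv κ s).re) {s t : ℂ}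
    (hs : s ∈ ball (0 : ℂ) 1) (hs0 : s ≠ 0) (hst : ‖s‖ = ‖t‖) (hne : s ≠ t) :
    ((H t / t - H s / s) * (starRingEnd ℂ) (exp (κ s) / s)).re < 0 := by
  have hnorm : ‖t / s‖ = 1 := by rw [norm_div, hst, div_self (hst ▸ norm_ne_zero_iff.mpr hs0)]
  have hexp : exp (arg (t / s) * I) = t / s := by
    have := norm_mul_exp_arg_mul_I (t / s)
    rwa [hnorm, ofReal_one, one_mul] at this
  have harg : arg (t / s) ≠ 0 := by
    intro h
    rw [h] at hexp
    simp at hexp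
    rw [eq_comm, div_eq_one_iff_eq hs0] at hexp
    exact hne hexp.symm
  have h1 := neg_pi_lt_arg (t / s)
  have h2 := arg_le_pi (t / s)
  obtain ⟨θ, hθ, hθe⟩ : ∃ θ ∈ Ioo 0 (2 * Real.pi), exp (-((θ : ℝ) * I)) = t / s := by
    rcases harg.lt_or_gt with hlt | hgt
    · refine ⟨-arg (t / s), ⟨by linarith, by linarith⟩, ?_⟩
      refine Eq.trans ?_ hexp
      push_cast
      ring_nf
    · refine ⟨2 * Real.pi - arg (t / s), ⟨by linarith [Real.pi_pos], by linarith⟩, ?_⟩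
      refine Eq.trans ?_ hexp
      push_cast
      rw [show -((2 * Real.pi - arg (t / s)) * I) = arg (t / s) * I - 2 * Real.pi * I by ring,
        exp_sub, exp_two_pi_mul_I, div_one]
  have := re_mul_conj_neg_of_exp hH hκ hk hN hs hs0 hθ
  rwa [hθe, mul_div_cancel₀ t hs0] at this

end Circle

/-! ### Sufficiency: positive curvature gives injectivity and a convex complement. -/

section Sufficiency

variable {H κ : ℂ → ℂ}

/-- `H s / s` is locally injective where `H - s H'` does not vanish, the pole included. -/
theorem exists_nhds_injective (hH : DifferentiableOn ℂ H (ball 0 1)) (hH0 : H 0 ≠ 0) {a : ℂ}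
    (ha : a ∈ ball (0 : ℂ) 1) (hk : H a - a * deriv H a ≠ 0) :
    ∃ U ∈ 𝓝 a, ∀ s ∈ U, ∀ t ∈ U, H s * t = H t * s → s = t := by
  have hHan := hH.analyticAt (isOpen_ball.mem_nhds ha)
  rcases eq_or_ne a 0 with rfl | ha0
  · have hd : HasDerivAt (fun s => s / H s) (H 0)⁻¹ 0 := by
      refine ((hasDerivAt_id (0 : ℂ)).div hHan.differentiableAt.hasDerivAt hH0).congr_deriv ?_
      simp only [id]
      field_simp
      ring
    have han : AnalyticAt ℂ (fun s => s / H s) 0 := analyticAt_id.div hHan hH0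
    have hs := han.hasStrictDerivAt
    rw [hd.deriv] at hs
    refine ⟨_, inter_mem (hs.eventually_left_inverse (inv_ne_zero hH0))
      (hHan.continuousAt.eventually_ne hH0), fun s hs t ht hst => ?_⟩
    have h1 : s / H s = t / H t := by
      rw [div_eq_div_iff hs.2 ht.2]; linear_combination -hst
    exact (hs.1.symm.trans (by rw [h1])).trans ht.1
  · have hd := hasDerivAt_div_self hH ha ha0
    have hs := (analyticAt_div_self hH ha ha0).hasStrictDerivAt
    rw [hd.deriv] at hs
    refine ⟨_, inter_mem (hs.eventually_left_inverse
      (div_ne_zero (neg_ne_zero.mpr hk) (pow_ne_zero 2 ha0)))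
      (continuousAt_id.eventually_ne ha0), fun s hs t ht hst => ?_⟩
    have h1 : H s / s = H t / t :=
      (div_eq_div_iff (show s ≠ 0 from hs.2) (show t ≠ 0 from ht.2)).mpr hst
    exact (hs.1.symm.trans (by rw [h1])).trans ht.1

/-- A collision `H s / s = H t / t` with `‖s‖ < ‖t‖` can be moved towards the origin. -/
theorem exists_smaller_collision (hH : DifferentiableOn ℂ H (ball 0 1)) (hH0 : H 0 ≠ 0) {s t : ℂ}
    (hs : s ∈ ball (0 : ℂ) 1) (ht : t ∈ ball (0 : ℂ) 1) (hk : H s - s * deriv H s ≠ 0)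
    (hst : H s * t = H t * s) (hlt : ‖s‖ < ‖t‖) :
    ∃ s' ∈ ball (0 : ℂ) 1, ∃ t' ∈ ball (0 : ℂ) 1, s' ≠ t' ∧ H s' * t' = H t' * s' ∧
      ‖s'‖ < ‖t‖ ∧ ‖t'‖ < ‖t‖ := by
  have ht0 : t ≠ 0 := norm_pos_iff.mp ((norm_nonneg s).trans_lt hlt)
  have hs0 : s ≠ 0 := by
    rintro rfl
    simp [hH0, ht0] at hst
  obtain ⟨ρ, hρ1, hρ2⟩ := exists_between hlt
  have hpre := eventually_exists_preimage hH hs hs0 hk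
    (isOpen_ball.mem_nhds (by simpa using hρ1) : ball (0 : ℂ) ρ ∈ 𝓝 s)
  have heq : H s / s = H t / t := by rw [div_eq_div_iff hs0 ht0]; exact hst
  rw [heq] at hpre
  have hc : Tendsto (fun c : ℝ => (c : ℂ) * t) (𝓝[<] 1) (𝓝 t) := by
    have : Continuous fun c : ℝ => (c : ℂ) * t := by fun_prop
    have := this.tendsto 1
    rw [ofReal_one, one_mul] at this
    exact this.mono_left nhdsWithin_le_nhds
  have e1 := hc.eventually ((analyticAt_div_self hH ht ht0).continuousAt.eventually hpre)
  have e2 : ∀ᶠ c : ℝ in 𝓝[<] 1, ρ < ‖(c : ℂ) * t‖ := hc.norm.eventually (lt_mem_nhds hρ2)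
  have e3 : ∀ᶠ c : ℝ in 𝓝[<] 1, c ∈ Ioo (0 : ℝ) 1 := Ioo_mem_nhdsLT one_pos
  obtain ⟨c, ⟨⟨s', hs'ρ, hs'b, hs'0, hs'eq⟩, hcρ⟩, hc01⟩ := ((e1.and e2).and e3).exists
  have hct : ‖(c : ℂ) * t‖ < ‖t‖ := by
    rw [norm_mul, norm_real, Real.norm_of_nonneg hc01.1.le]
    have := norm_pos_iff.mpr ht0
    nlinarith [hc01.2]
  have hs'ρ' : ‖s'‖ < ρ := by simpa using hs'ρ
  have hct0 : (c : ℂ) * t ≠ 0 := norm_pos_iff.mp ((norm_nonneg s').trans_lt (hs'ρ'.trans hcρ))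
  refine ⟨s', hs'b, c * t, ?_, ?_, ?_, hs'ρ'.trans hρ2, hct⟩
  · rw [mem_ball_zero_iff] at ht ⊢
    exact hct.trans ht
  · rintro rfl
    exact lt_asymm hs'ρ' hcρ
  · rw [hs'eq, mul_right_comm, div_mul_cancel₀ _ hct0]

/-- Take a collision minimizing the larger modulus. In the limit the two points cannot merge, by
local injectivity; they cannot have different moduli, since the collision could be pushed inwards;
and they cannot have equal moduli, by strict convexity of the image circle. -/
theorem injective_of_exp (hH : DifferentiableOn ℂ H (ball 0 1)) (hH0 : H 0 ≠ 0)
    (hκ : DifferentiableOn ℂ κ (ball 0 1))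
    (hk : ∀ s ∈ ball (0 : ℂ) 1, H s - s * deriv H s = exp (κ s))
    (hN : ∀ s ∈ ball (0 : ℂ) 1, 0 < (1 - s * deriv κ s).re) :
    ∀ s ∈ ball (0 : ℂ) 1, ∀ t ∈ ball (0 : ℂ) 1, H s * t = H t * s → s = t := by
  have hk0 : ∀ s ∈ ball (0 : ℂ) 1, H s - s * deriv H s ≠ 0 := fun s hs => by
    rw [hk s hs]; exact exp_ne_zero _
  intro s₀ hs₀ t₀ ht₀ heq₀
  by_contra hne₀
  set S : Set (ℂ × ℂ) := {q | q.1 ∈ ball (0 : ℂ) 1 ∧ q.2 ∈ ball (0 : ℂ) 1 ∧ q.1 ≠ q.2 ∧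
    H q.1 * q.2 = H q.2 * q.1} with hS
  set m : ℂ × ℂ → ℝ := fun q => max ‖q.1‖ ‖q.2‖ with hm
  have hm_cont : Continuous m := by fun_prop
  have hne : (m '' S).Nonempty := ⟨_, (s₀, t₀), ⟨hs₀, ht₀, hne₀, heq₀⟩, rfl⟩
  have hbdd : BddBelow (m '' S) :=
    ⟨0, by rintro _ ⟨q, -, rfl⟩; exact (norm_nonneg _).trans (le_max_left _ _)⟩
  obtain ⟨v, -, hvlim, hv⟩ := exists_seq_tendsto_sInf hne hbdd
  set μ := sInf (m '' S)
  have hμle : ∀ q ∈ S, μ ≤ m q := fun q hq => csInf_le hbdd ⟨q, hq, rfl⟩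
  have hμ1 : μ < 1 := (hμle (s₀, t₀) ⟨hs₀, ht₀, hne₀, heq₀⟩).trans_lt
    (max_lt (by simpa using hs₀) (by simpa using ht₀))
  choose q hqS hqv using hv
  have hqc : ∀ n, q n ∈ closedBall (0 : ℂ) 1 ×ˢ closedBall (0 : ℂ) 1 := fun n =>
    ⟨ball_subset_closedBall (hqS n).1, ball_subset_closedBall (hqS n).2.1⟩
  obtain ⟨⟨s, t⟩, -, φ, hφ, hlim⟩ :=
    ((isCompact_closedBall (0 : ℂ) 1).prod (isCompact_closedBall (0 : ℂ) 1)).tendsto_subseq hqc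
  have hlim1 : Tendsto (fun n => (q (φ n)).1) atTop (𝓝 s) := (continuous_fst.tendsto _).comp hlim
  have hlim2 : Tendsto (fun n => (q (φ n)).2) atTop (𝓝 t) := (continuous_snd.tendsto _).comp hlim
  have hmμ : max ‖s‖ ‖t‖ = μ := by
    refine tendsto_nhds_unique ((hm_cont.tendsto _).comp hlim) ?_
    refine (hvlim.comp hφ.tendsto_atTop).congr fun n => ?_
    simp only [Function.comp, ← hqv]
  have hsb : s ∈ ball (0 : ℂ) 1 := by
    rw [mem_ball_zero_iff]; exact (le_max_left _ _).trans_lt (hmμ ▸ hμ1)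
  have htb : t ∈ ball (0 : ℂ) 1 := by
    rw [mem_ball_zero_iff]; exact (le_max_right _ _).trans_lt (hmμ ▸ hμ1)
  have hHs := (hH.differentiableAt (isOpen_ball.mem_nhds hsb)).continuousAt.tendsto
  have hHt := (hH.differentiableAt (isOpen_ball.mem_nhds htb)).continuousAt.tendsto
  have heq : H s * t = H t * s :=
    tendsto_nhds_unique ((hHs.comp hlim1).mul hlim2)
      (((hHt.comp hlim2).mul hlim1).congr fun n => (hqS (φ n)).2.2.2.symm)
  rcases eq_or_ne s t with rfl | hst
  · obtain ⟨U, hU, hinj⟩ := exists_nhds_injective hH hH0 hsb (hk0 s hsb)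
    obtain ⟨n, hn1, hn2⟩ := ((hlim1.eventually hU).and (hlim2.eventually hU)).exists
    exact (hqS (φ n)).2.2.1 (hinj _ hn1 _ hn2 (hqS (φ n)).2.2.2)
  · rcases lt_trichotomy ‖s‖ ‖t‖ with hlt | hnorm | hgt
    · obtain ⟨s', hs', t', ht', hne', heq', h1, h2⟩ :=
        exists_smaller_collision hH hH0 hsb htb (hk0 s hsb) heq hlt
      have := hμle (s', t') ⟨hs', ht', hne', heq'⟩
      rw [← hmμ, max_eq_right hlt.le] at this
      exact absurd (max_lt h1 h2) (not_lt.mpr this)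
    · have hs0 : s ≠ 0 := by
        rintro rfl
        rw [norm_zero] at hnorm
        exact hst (norm_eq_zero.mp hnorm.symm).symm
      have ht0 : t ≠ 0 := norm_ne_zero_iff.mp (hnorm ▸ norm_ne_zero_iff.mpr hs0)
      have := re_mul_conj_neg hH hκ hk hN hsb hs0 hnorm hst
      have h2 : H t / t - H s / s = 0 := by
        rw [sub_eq_zero, div_eq_div_iff ht0 hs0]; exact heq.symm
      rw [h2, zero_mul, zero_re] at this
      exact lt_irrefl _ this
    · obtain ⟨s', hs', t', ht', hne', heq', h1, h2⟩ :=
        exists_smaller_collision hH hH0 htb hsb (hk0 t htb) heq.symm hgt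
      have := hμle (s', t') ⟨hs', ht', hne', heq'⟩
      rw [← hmμ, max_eq_left hgt.le] at this
      exact absurd (max_lt h1 h2) (not_lt.mpr this)

/-- The omitted set lies strictly on one side of each tangent line to the image of a circle. -/
theorem omitted_re_mul_conj_neg (hH : DifferentiableOn ℂ H (ball 0 1)) (hH0 : H 0 ≠ 0)
    (hκ : DifferentiableOn ℂ κ (ball 0 1))
    (hk : ∀ s ∈ ball (0 : ℂ) 1, H s - s * deriv H s = exp (κ s))
    (hN : ∀ s ∈ ball (0 : ℂ) 1, 0 < (1 - s * deriv κ s).re) {s y : ℂ}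
    (hs : s ∈ ball (0 : ℂ) 1) (hs0 : s ≠ 0) (hy : y ∈ omitted H) :
    ((y - H s / s) * (starRingEnd ℂ) (exp (κ s) / s)).re < 0 := by
  set n := exp (κ s) / s with hn
  have hn0 : n ≠ 0 := div_ne_zero (exp_ne_zero _) hs0
  set x := H s / s with hx
  have hs1 : ‖s‖ < 1 := by simpa using hs
  have hspos : 0 < ‖s‖ := norm_pos_iff.mpr hs0
  set E : Set ℂ := {y | ∃ t ∈ ball (0 : ℂ) ‖s‖, H t = y * t} with hE
  set F : Set ℂ := {y | ∃ t ∈ closedBall (0 : ℂ) ‖s‖, H t = y * t} with hF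
  have hsub : closedBall (0 : ℂ) ‖s‖ ⊆ ball 0 1 := closedBall_subset_ball hs1
  have hEF : E ⊆ F := fun y ⟨t, ht, h⟩ => ⟨t, ball_subset_closedBall ht, h⟩
  have ht0 : ∀ {y t : ℂ}, H t = y * t → t ≠ 0 := by
    rintro y t h rfl
    rw [mul_zero] at h
    exact hH0 h
  have hFclosed : IsClosed F := by
    refine IsSeqClosed.isClosed fun u a hu hua => ?_
    choose t ht hteq using hu
    obtain ⟨b, hb, φ, hφ, hlim⟩ := (isCompact_closedBall (0 : ℂ) ‖s‖).tendsto_subseq ht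
    refine ⟨b, hb, ?_⟩
    have h1 := (hH.differentiableAt (isOpen_ball.mem_nhds (hsub hb))).continuousAt.tendsto.comp hlim
    refine tendsto_nhds_unique h1 (((hua.comp hφ.tendsto_atTop).mul hlim).congr fun k => ?_)
    exact (hteq (φ k)).symm
  have hEopen : IsOpen E := by
    rw [isOpen_iff_mem_nhds]
    rintro a ⟨t, ht, hteq⟩
    have htb := hsub (ball_subset_closedBall ht)
    have := eventually_exists_preimage hH htb (ht0 hteq) (by rw [hk t htb]; exact exp_ne_zero _)
      (isOpen_ball.mem_nhds ht)
    rw [hteq, mul_div_cancel_right₀ _ (ht0 hteq)] at this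
    filter_upwards [this] with b hb
    obtain ⟨u, hu, -, -, hueq⟩ := hb
    exact ⟨u, hu, hueq⟩
  set P : Set ℂ := {y | 0 < ((y - x) * (starRingEnd ℂ) n).re} with hP
  have hPconv : Convex ℝ P := by
    intro a ha b hb α β hα hβ hαβ
    simp only [hP, mem_ofPred_eq] at ha hb ⊢
    have e : ((α • a + β • b - x) * (starRingEnd ℂ) n) =
        α * ((a - x) * (starRingEnd ℂ) n) + β * ((b - x) * (starRingEnd ℂ) n) := by
      have : (α : ℂ) + β = 1 := by exact_mod_cast hαβ
      simp only [real_smul]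
      linear_combination (x * (starRingEnd ℂ) n) * this
    rw [e, add_re, re_ofReal_mul, re_ofReal_mul]
    rcases hα.lt_or_eq with h | h
    · nlinarith [mul_pos h ha, mul_nonneg hβ hb.le]
    · have : β = 1 := by linarith
      rw [← h, this]
      linarith
  have hPF : ∀ a ∈ P, a ∈ F → a ∈ E := by
    rintro a ha ⟨t, ht, hteq⟩
    rw [mem_closedBall_zero_iff] at ht
    rcases ht.lt_or_eq with hlt | heq
    · exact ⟨t, by simpa using hlt, hteq⟩
    · exfalso
      have hat : a = H t / t := by rw [hteq, mul_div_cancel_right₀ _ (ht0 hteq)]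
      simp only [hP, mem_ofPred_eq, hat] at ha
      rcases eq_or_ne s t with rfl | hst
      · simp [hx] at ha
      · exact lt_asymm ha (re_mul_conj_neg hH hκ hk hN hs hs0 heq.symm hst)
  have hline : ∀ c : ℝ, ∀ a : ℂ, ((a + c * n - x) * (starRingEnd ℂ) n).re =
      ((a - x) * (starRingEnd ℂ) n).re + c * ‖n‖ ^ 2 := by
    intro c a
    have : (a + c * n - x) * (starRingEnd ℂ) n =
        (a - x) * (starRingEnd ℂ) n + ((c * ‖n‖ ^ 2 : ℝ) : ℂ) := by
      push_cast
      rw [← mul_conj']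
      ring
    rw [this, add_re, ofReal_re]
  have hnn : 0 < ‖n‖ ^ 2 := by positivity
  -- The half-plane P beyond the tangent line misses the image of the circle itself, so it is
  -- covered by the disjoint open sets E and Fᶜ. It is connected and contains large values, taken
  -- near the pole, so it lies in E.
  have hPE : P ⊆ E := by
    refine hPconv.isPreconnected.subset_left_of_subset_union hEopen hFclosed.isOpen_compl
      (disjoint_left.mpr fun a ha hac => hac (hEF ha)) (fun a ha => ?_) ?_
    · by_cases haF : a ∈ F
      · exact Or.inl (hPF a ha haF)
      · exact Or.inr haF
    · obtain ⟨R, hR⟩ := exists_preimage_of_large hH hH0 (ball_mem_nhds (0 : ℂ) hspos)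
      have hnpos : 0 < ‖n‖ := norm_pos_iff.mpr hn0
      obtain ⟨M, hM⟩ := exists_gt (max 0 ((R + ‖x‖) / ‖n‖))
      have hM0 : 0 < M := (le_max_left _ _).trans_lt hM
      have hM1 : R + ‖x‖ < M * ‖n‖ := (div_lt_iff₀ hnpos).mp ((le_max_right _ _).trans_lt hM)
      refine ⟨x + M * n, ?_, ?_⟩
      · simp only [hP, mem_ofPred_eq, hline, sub_self, zero_mul, zero_re, zero_add]
        positivity
      · have : R < ‖x + M * n‖ := by
          have h1 := norm_sub_le (x + M * n) x
          rw [add_sub_cancel_left, norm_mul, norm_real, Real.norm_of_nonneg hM0.le] at h1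
          linarith
        obtain ⟨t, ht, -, -, hteq⟩ := hR _ this
        exact ⟨t, ht, hteq⟩
  by_contra! hcon
  have hyF : y ∈ F := by
    have hlim : Tendsto (fun ε : ℝ => y + ε * n) (𝓝[>] 0) (𝓝 y) := by
      have : Continuous fun ε : ℝ => y + ε * n := by fun_prop
      have := this.tendsto 0
      simp only [ofReal_zero, zero_mul, add_zero] at this
      exact this.mono_left nhdsWithin_le_nhds
    refine hFclosed.mem_of_tendsto hlim ?_
    filter_upwards [self_mem_nhdsWithin] with ε hε
    refine hEF (hPE ?_)
    simp only [hP, mem_ofPred_eq, hline]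
    have : 0 < ε * ‖n‖ ^ 2 := mul_pos hε hnn
    linarith
  obtain ⟨t, ht, hteq⟩ := hyF
  exact hy t (hsub ht) hteq

/-- At each finite value H(s)/s the omitted set lies strictly on one side of a line through that
value, so the value is no convex combination of omitted points. -/
theorem convex_omitted_of_exp (hH : DifferentiableOn ℂ H (ball 0 1)) (hH0 : H 0 ≠ 0)
    (hκ : DifferentiableOn ℂ κ (ball 0 1))
    (hk : ∀ s ∈ ball (0 : ℂ) 1, H s - s * deriv H s = exp (κ s))
    (hN : ∀ s ∈ ball (0 : ℂ) 1, 0 < (1 - s * deriv κ s).re) : Convex ℝ (omitted H) := by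
  intro a ha b hb α β hα hβ hαβ s hs hcon
  have hs0 : s ≠ 0 := by
    rintro rfl
    rw [mul_zero] at hcon
    exact hH0 hcon
  have h1 := omitted_re_mul_conj_neg hH hH0 hκ hk hN hs hs0 ha
  have h2 := omitted_re_mul_conj_neg hH hH0 hκ hk hN hs hs0 hb
  have hx : H s / s = α * a + β * b := by
    rw [hcon, mul_div_cancel_right₀ _ hs0, real_smul, real_smul]
  have e : α * ((a - H s / s) * (starRingEnd ℂ) (exp (κ s) / s)) +
      β * ((b - H s / s) * (starRingEnd ℂ) (exp (κ s) / s)) = 0 := by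
    have : (α : ℂ) + β = 1 := by exact_mod_cast hαβ
    rw [hx]
    generalize (starRingEnd ℂ) (exp (κ s) / s) = n
    linear_combination (-(α * a + β * b) * n) * this
  have e' := congrArg re e
  rw [add_re, re_ofReal_mul, re_ofReal_mul, zero_re] at e'
  rcases hα.lt_or_eq with h | h
  · nlinarith [mul_neg_of_pos_of_neg h h1, mul_nonneg hβ (neg_nonneg.mpr h2.le)]
  · have : β = 1 := by linarith
    rw [← h, this] at e'
    linarith

end Sufficiency

/-! ### Solving the differential equation for a given bounded ψ. -/

theorem one_sub_sq_mul_ne_zero {ψ s : ℂ} (hψ : ‖ψ‖ ≤ 1) (hs : ‖s‖ < 1) : 1 - s ^ 2 * ψ ≠ 0 := by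
  intro h
  have h1 : s ^ 2 * ψ = 1 := (sub_eq_zero.mp h).symm
  have h2 := congrArg norm h1
  rw [norm_mul, norm_pow, norm_one] at h2
  nlinarith [norm_nonneg s, norm_nonneg ψ, sq_nonneg ‖s‖]

/-- Integration of the differential equation `H'' (1 - s² ψ) = 2 (H - s H') ψ`. -/
theorem exists_of_bounded {ψ : ℂ → ℂ} (hψ : DifferentiableOn ℂ ψ (ball 0 1))
    (hb : ∀ s ∈ ball (0 : ℂ) 1, ‖ψ s‖ ≤ 1) {a c : ℂ} (ha : a ∈ ball (0 : ℂ) 1) (ha0 : a ≠ 0)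
    (hc : c ≠ 0) :
    ∃ H κ : ℂ → ℂ, DifferentiableOn ℂ H (ball 0 1) ∧ DifferentiableOn ℂ κ (ball 0 1) ∧
      H 0 ≠ 0 ∧ H a = 0 ∧ H a - a * deriv H a = c ∧
      (∀ s ∈ ball (0 : ℂ) 1, H s - s * deriv H s = exp (κ s)) ∧
      (∀ s ∈ ball (0 : ℂ) 1, 0 < (1 - s * deriv κ s).re) ∧
      ∀ s ∈ ball (0 : ℂ) 1,
        deriv (deriv H) s * (1 - s ^ 2 * ψ s) = 2 * (H s - s * deriv H s) * ψ s := by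
  have h0 : (0 : ℂ) ∈ ball (0 : ℂ) 1 := by simp
  have hden : ∀ s ∈ ball (0 : ℂ) 1, 1 - s ^ 2 * ψ s ≠ 0 := fun s hs =>
    one_sub_sq_mul_ne_zero (hb s hs) (by simpa using hs)
  have hdend : DifferentiableOn ℂ (fun s => 1 - s ^ 2 * ψ s) (ball 0 1) :=
    (differentiableOn_const _).sub ((differentiableOn_id.pow 2).mul hψ)
  have hκ'd : DifferentiableOn ℂ (fun s => -(2 * s * ψ s) / (1 - s ^ 2 * ψ s)) (ball 0 1) :=
    DifferentiableOn.div ((differentiableOn_id.const_mul 2).mul hψ).neg hdend hden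
  -- For k = H - sH' one has k' = -sH'', so the equation prescribes (log k)' = -2sψ/(1 - s²ψ). The
  -- constant of integration fixes k(a) = c.
  obtain ⟨κ, hκa, hκ⟩ := hκ'd.isExactOn_ball.with_val_at a (log c)
  have hκd : DifferentiableOn ℂ κ (ball 0 1) := fun s hs =>
    (hκ s hs).differentiableAt.differentiableWithinAt
  have hH''d : DifferentiableOn ℂ (fun s => 2 * exp (κ s) * ψ s / (1 - s ^ 2 * ψ s)) (ball 0 1) :=
    DifferentiableOn.div ((hκd.cexp.const_mul 2).mul hψ) hdend hden
  obtain ⟨H₁, hH₁⟩ := hH''d.isExactOn_ball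
  have hH₁d : DifferentiableOn ℂ H₁ (ball 0 1) := fun s hs =>
    (hH₁ s hs).differentiableAt.differentiableWithinAt
  obtain ⟨H₀, hH₀0, hH₀⟩ := hH₁d.isExactOn_ball.with_val_at 0 (exp (κ 0))
  have hkd : ∀ s ∈ ball (0 : ℂ) 1, HasDerivAt (fun s => H₀ s - s * H₁ s - exp (κ s)) 0 s := by
    intro s hs
    refine (((hH₀ s hs).sub ((hasDerivAt_id s).mul (hH₁ s hs))).sub
      ((hκ s hs).cexp)).congr_deriv ?_
    have := hden s hs
    simp only [id]
    field_simp
    ring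
  have hk : ∀ s ∈ ball (0 : ℂ) 1, H₀ s - s * H₁ s = exp (κ s) := by
    intro s hs
    have := isOpen_ball.is_const_of_deriv_eq_zero (convex_ball (0 : ℂ) 1).isPreconnected
      (fun s hs => (hkd s hs).differentiableAt.differentiableWithinAt)
      (fun s hs => (hkd s hs).deriv) hs h0
    simp only [hH₀0, zero_mul, sub_zero, sub_self] at this
    exact sub_eq_zero.mp this
  -- Adding a multiple of s leaves H - sH' and H'' unchanged, so it can be used to make H vanish at
  -- a.
  set e := -(H₀ a / a) with he
  have hHd : ∀ s ∈ ball (0 : ℂ) 1, HasDerivAt (fun s => H₀ s + e * s) (H₁ s + e) s := by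
    intro s hs
    refine ((hH₀ s hs).add ((hasDerivAt_id s).const_mul e)).congr_deriv ?_
    simp
  have hHdd : ∀ s ∈ ball (0 : ℂ) 1, deriv (deriv fun s => H₀ s + e * s) s =
      2 * exp (κ s) * ψ s / (1 - s ^ 2 * ψ s) := by
    intro s hs
    have : deriv (fun s => H₀ s + e * s) =ᶠ[𝓝 s] fun s => H₁ s + e := by
      filter_upwards [isOpen_ball.mem_nhds hs] with t ht
      exact (hHd t ht).deriv
    rw [this.deriv_eq, ((hH₁ s hs).add_const e).deriv]
  have hkH : ∀ s ∈ ball (0 : ℂ) 1,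
      (fun s => H₀ s + e * s) s - s * deriv (fun s => H₀ s + e * s) s = exp (κ s) := by
    intro s hs
    rw [(hHd s hs).deriv, ← hk s hs]
    ring
  refine ⟨fun s => H₀ s + e * s, κ, fun s hs => (hHd s hs).differentiableAt.differentiableWithinAt,
    hκd, ?_, ?_, ?_, hkH, ?_, ?_⟩
  · simp [hH₀0]
  · simp only [he]
    field_simp
    ring
  · rw [hkH a ha, hκa, exp_log hc]
  · intro s hs
    rw [(hκ s hs).deriv]
    have hd := hden s hs
    have e1 : 1 - s * (-(2 * s * ψ s) / (1 - s ^ 2 * ψ s)) =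
        (1 + s ^ 2 * ψ s) / (1 - s ^ 2 * ψ s) := by
      field_simp
      ring
    rw [e1]
    have hlt : ‖s ^ 2 * ψ s‖ < 1 := by
      have hs1 : ‖s‖ < 1 := by simpa using hs
      rw [norm_mul, norm_pow]
      nlinarith [norm_nonneg s, norm_nonneg (ψ s), hb s hs]
    generalize s ^ 2 * ψ s = X at *
    rw [Complex.div_re, ← add_div]
    refine div_pos ?_ (normSq_pos.mpr hd)
    have hX : normSq X < 1 := by
      rw [normSq_eq_norm_sq]
      nlinarith [norm_nonneg X]
    rw [normSq_apply] at hX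
    simp
    nlinarith
  · intro s hs
    rw [hkH s hs, hHdd s hs, div_mul_cancel₀ _ (hden s hs)]

/-! ### The disk automorphism and the formula for a₃ - a₂². -/

/-- The disk automorphism carrying `p` to the origin. -/
noncomputable def poleToZero (p : ℝ) (z : ℂ) : ℂ := (z - p) / (1 - p * z)

theorem one_sub_mul_ne_zero {p : ℝ} (hp0 : -1 < p) (hp1 : p < 1) {z : ℂ} (hz : ‖z‖ ≤ 1) :
    1 - (p : ℂ) * z ≠ 0 := by
  intro h
  have h1 : (p : ℂ) * z = 1 := (sub_eq_zero.mp h).symm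
  have h2 := congrArg norm h1
  rw [norm_mul, norm_one, norm_real, Real.norm_eq_abs] at h2
  nlinarith [norm_nonneg z, abs_lt.mpr ⟨hp0, hp1⟩, abs_nonneg p]

theorem hasDerivAt_poleToZero {p : ℝ} (hp0 : -1 < p) (hp1 : p < 1) {z : ℂ} (hz : ‖z‖ ≤ 1) :
    HasDerivAt (poleToZero p) ((1 - (p : ℂ) ^ 2) / (1 - p * z) ^ 2) z := by
  refine (((hasDerivAt_id z).sub_const (p : ℂ)).div
    (((hasDerivAt_id z).const_mul (p : ℂ)).const_sub 1)
    (one_sub_mul_ne_zero hp0 hp1 hz)).congr_deriv ?_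
  simp only [id]
  ring

theorem poleToZero_mem {p : ℝ} (hp0 : -1 < p) (hp1 : p < 1) {z : ℂ} (hz : z ∈ ball (0 : ℂ) 1) :
    poleToZero p z ∈ ball (0 : ℂ) 1 := by
  rw [mem_ball_zero_iff] at hz ⊢
  rw [poleToZero, norm_div, div_lt_one (norm_pos_iff.mpr (one_sub_mul_ne_zero hp0 hp1 hz.le))]
  refine (sq_lt_sq₀ (norm_nonneg _) (norm_nonneg _)).mp ?_
  have e1 : ‖1 - (p : ℂ) * z‖ ^ 2 - ‖z - p‖ ^ 2 = (1 - p ^ 2) * (1 - ‖z‖ ^ 2) := by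
    simp only [Complex.sq_norm, Complex.normSq_apply]
    simp
    ring
  have : 0 < (1 - p ^ 2) * (1 - ‖z‖ ^ 2) := by
    apply mul_pos <;> nlinarith [norm_nonneg z]
  linarith

theorem poleToZero_zero (p : ℝ) : poleToZero p 0 = -p := by simp [poleToZero]

/-- The derivative of a function with given first logarithmic derivative determines the first
coefficients. -/
theorem feketeSzego_one_eq {f D L : ℂ → ℂ} {L' : ℂ} (hf : deriv f =ᶠ[𝓝 0] D)
    (hD : ∀ᶠ z in 𝓝 0, HasDerivAt D (D z * L z) z) (hD0 : D 0 = 1) (hL : HasDerivAt L L' 0) :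
    feketeSzego 1 f = L' / 6 - L 0 ^ 2 / 12 := by
  have h2 : deriv (deriv f) =ᶠ[𝓝 0] fun z => D z * L z := by
    refine hf.deriv.trans ?_
    filter_upwards [hD] with z hz
    exact hz.deriv
  have i2 : iteratedDeriv 2 f 0 = L 0 := by
    rw [iteratedDeriv_succ, iteratedDeriv_one, h2.self_of_nhds]
    simp only [hD0, one_mul]
  have i3 : iteratedDeriv 3 f 0 = L 0 ^ 2 + L' := by
    have h3 : HasDerivAt (fun z => D z * L z) _ 0 := hD.self_of_nhds.mul hL
    rw [iteratedDeriv_succ, iteratedDeriv_succ, iteratedDeriv_one, h2.deriv_eq, h3.deriv, hD0]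
    ring
  simp only [feketeSzego, taylorCoeff, i2, i3, Nat.factorial]
  push_cast
  ring

/-- Here f' = -(1 - p²)k/(z - p)² with k = H - sH' taken at s = `poleToZero p z`. The equation gives
k'/k = -2sψ/(1 - s²ψ), so f''/f' depends only on z and χ = ψ ∘ `poleToZero p`, and the functional
only on χ(0) and χ'(0). -/
theorem feketeSzego_eq_of_ode {p : ℝ} (hp0 : 0 < p) (hp1 : p < 1) {f H ψ : ℂ → ℂ}
    (hH : DifferentiableOn ℂ H (ball 0 1)) (hψ : DifferentiableOn ℂ ψ (ball 0 1))
    (hb : ∀ s ∈ ball (0 : ℂ) 1, ‖ψ s‖ ≤ 1)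
    (hode : ∀ s ∈ ball (0 : ℂ) 1,
        deriv (deriv H) s * (1 - s ^ 2 * ψ s) = 2 * (H s - s * deriv H s) * ψ s)
    (hf : f =ᶠ[𝓝 0] fun z => H (poleToZero p z) / poleToZero p z) (hf1 : deriv f 0 = 1) :
    feketeSzego 1 f = (-(1 - (p : ℂ) ^ 2) ^ 2 * ψ (poleToZero p 0) +
      p * (1 - (p : ℂ) ^ 2) / 3 * deriv (fun z => ψ (poleToZero p z)) 0) /
        (1 - (p : ℂ) ^ 2 * ψ (poleToZero p 0)) ^ 2 := by
  have hp2 : -1 < p := by linarith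
  have hpc : (p : ℂ) ≠ 0 := ofReal_ne_zero.mpr hp0.ne'
  set χ : ℂ → ℂ := fun z => ψ (poleToZero p z) with hχ
  have h0 : (0 : ℂ) ∈ ball (0 : ℂ) 1 := by simp
  have hsmall : ∀ᶠ z in 𝓝 (0 : ℂ), z ∈ ball (0 : ℂ) 1 ∧ z ≠ p :=
    (isOpen_ball.eventually_mem h0).and (continuousAt_id.eventually_ne (by simpa using hpc.symm))
  have hT0 : ∀ z : ℂ, z ∈ ball (0 : ℂ) 1 → z ≠ p → poleToZero p z ≠ 0 := fun z hz hzp =>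
    div_ne_zero (sub_ne_zero.mpr hzp) (one_sub_mul_ne_zero hp2 hp1 (by simpa using hz.out.le))
  have hTd : ∀ z ∈ ball (0 : ℂ) 1, HasDerivAt (poleToZero p)
      ((1 - (p : ℂ) ^ 2) / (1 - p * z) ^ 2) z := fun z hz =>
    hasDerivAt_poleToZero hp2 hp1 (by simpa using hz.out.le)
  set D : ℂ → ℂ := fun z => -(1 - (p : ℂ) ^ 2) *
    (H (poleToZero p z) - poleToZero p z * deriv H (poleToZero p z)) / (z - p) ^ 2 with hD
  set M : ℂ → ℂ := fun z => (1 - p * z) * ((1 - p * z) ^ 2 - (z - p) ^ 2 * χ z) with hM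
  set L : ℂ → ℂ := fun z => -2 / (z - p) - 2 * (1 - (p : ℂ) ^ 2) * ((z - p) * χ z) / M z with hL
  have hf' : deriv f =ᶠ[𝓝 0] D := by
    refine hf.deriv.trans ?_
    filter_upwards [hsmall] with z ⟨hz, hzp⟩
    have hq := one_sub_mul_ne_zero hp2 hp1 (by simpa using hz.out.le : ‖z‖ ≤ 1)
    have hq' : 1 - z * (p : ℂ) ≠ 0 := by rwa [mul_comm]
    have := (hasDerivAt_div_self hH (poleToZero_mem hp2 hp1 hz) (hT0 z hz hzp)).comp z (hTd z hz)
    have h2 : deriv (fun z => H (poleToZero p z) / poleToZero p z) z = _ := this.deriv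
    rw [h2]
    simp only [hD]
    generalize hk : H (poleToZero p z) - poleToZero p z * deriv H (poleToZero p z) = k
    have hzp' : z - p ≠ 0 := sub_ne_zero.mpr hzp
    simp only [poleToZero]
    field_simp
  have hDd : ∀ᶠ z in 𝓝 0, HasDerivAt D (D z * L z) z := by
    filter_upwards [hsmall] with z ⟨hz, hzp⟩
    have hq := one_sub_mul_ne_zero hp2 hp1 (by simpa using hz.out.le : ‖z‖ ≤ 1)
    have hq' : 1 - z * (p : ℂ) ≠ 0 := by rwa [mul_comm]
    have hzp' : z - p ≠ 0 := sub_ne_zero.mpr hzp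
    have hTm := poleToZero_mem hp2 hp1 hz
    have h1 := (hasDerivAt_sub_mul_deriv hH hTm).comp z (hTd z hz)
    have h2 : HasDerivAt (fun z => (z - (p : ℂ)) ^ 2) (2 * (z - p)) z := by
      refine (((hasDerivAt_id z).sub_const (p : ℂ)).pow 2).congr_deriv ?_
      simp
    have h3 : HasDerivAt D _ z := (h1.const_mul (-(1 - (p : ℂ) ^ 2))).div h2 (pow_ne_zero 2 hzp')
    refine h3.congr_deriv ?_
    have hden := one_sub_sq_mul_ne_zero (hb _ hTm) (by simpa using hTm)
    have hode' := hode _ hTm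
    rw [← eq_div_iff hden] at hode'
    rw [hode']
    simp only [hD, hL, hM, hχ, Function.comp]
    generalize H (poleToZero p z) - poleToZero p z * deriv H (poleToZero p z) = k
    generalize ψ (poleToZero p z) = x at *
    have hm : (1 - p * z) ^ 2 - (z - p) ^ 2 * x ≠ 0 := by
      intro h
      apply hden
      rw [poleToZero, div_pow, div_mul_eq_mul_div, ← sub_eq_zero.mp h,
        div_self (pow_ne_zero 2 hq), sub_self]
    have hm' : (1 - z * p) ^ 2 - (z - p) ^ 2 * x ≠ 0 := by rwa [mul_comm z]
    have hden' : 1 - poleToZero p z ^ 2 * x = ((1 - p * z) ^ 2 - (z - p) ^ 2 * x) /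
        (1 - p * z) ^ 2 := by
      rw [poleToZero, div_pow, sub_div, div_self (pow_ne_zero 2 hq)]
      ring
    rw [hden']
    simp only [poleToZero]
    field_simp
    ring
  have hD0 : D 0 = 1 := by rw [← hf'.self_of_nhds, hf1]
  have hTm0 := poleToZero_mem hp2 hp1 h0
  have hχd : HasDerivAt χ (deriv χ 0) 0 := by
    have : DifferentiableAt ℂ χ 0 :=
      (hψ.differentiableAt (isOpen_ball.mem_nhds hTm0)).comp (0 : ℂ) (hTd 0 h0).differentiableAt
    exact this.hasDerivAt
  have hb0 : 1 - (p : ℂ) ^ 2 * χ 0 ≠ 0 := by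
    have := one_sub_sq_mul_ne_zero (hb _ hTm0) (by simpa using hTm0)
    rw [poleToZero_zero, neg_sq] at this
    simpa only [hχ, poleToZero_zero] using this
  have hM0 : M 0 = 1 - (p : ℂ) ^ 2 * χ 0 := by simp [hM]
  have hMd : HasDerivAt M (-p * (1 - (p : ℂ) ^ 2 * χ 0) +
      (-2 * p + 2 * p * χ 0 - (p : ℂ) ^ 2 * deriv χ 0)) 0 := by
    have h1 : HasDerivAt (fun z : ℂ => 1 - (p : ℂ) * z) (-p) 0 := by
      refine (((hasDerivAt_id (0 : ℂ)).const_mul (p : ℂ)).const_sub 1).congr_deriv ?_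
      simp
    have h2 : HasDerivAt (fun z : ℂ => z - (p : ℂ)) 1 0 := (hasDerivAt_id (0 : ℂ)).sub_const _
    refine (h1.mul ((h1.pow 2).sub ((h2.pow 2).mul hχd))).congr_deriv ?_
    simp
    ring
  have hLd : HasDerivAt L (2 / (p : ℂ) ^ 2 - 2 * (1 - (p : ℂ) ^ 2) *
      ((χ 0 - p * deriv χ 0) * M 0 + p * χ 0 * (-p * (1 - (p : ℂ) ^ 2 * χ 0) +
      (-2 * p + 2 * p * χ 0 - (p : ℂ) ^ 2 * deriv χ 0))) / M 0 ^ 2) 0 := by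
    have h2 : HasDerivAt (fun z : ℂ => z - (p : ℂ)) 1 0 := (hasDerivAt_id (0 : ℂ)).sub_const _
    refine (((hasDerivAt_const (0 : ℂ) (-2 : ℂ)).div h2 (by simpa using hpc)).sub
      (((h2.mul hχd).const_mul (2 * (1 - (p : ℂ) ^ 2))).div hMd (hM0 ▸ hb0))).congr_deriv ?_
    simp
    ring
  rw [feketeSzego_one_eq hf' hDd hD0 hLd]
  simp only [hL, hM0]
  rw [show ψ (poleToZero p 0) = χ 0 from rfl]
  field_simp
  ring

theorem poleToZero_neg_left {p : ℝ} (hp0 : -1 < p) (hp1 : p < 1) {z : ℂ} (hz : ‖z‖ ≤ 1) :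
    poleToZero (-p) (poleToZero p z) = z := by
  have h1 := one_sub_mul_ne_zero hp0 hp1 hz
  have h2 : (1 : ℂ) - p * p ≠ 0 :=
    one_sub_mul_ne_zero hp0 hp1 (by rw [norm_real]; exact (abs_lt.mpr ⟨hp0, hp1⟩).le)
  have h3 : 1 - (-(p : ℂ)) * poleToZero p z = (1 - p * p) / (1 - p * z) := by
    rw [poleToZero, eq_div_iff h1, sub_mul, mul_assoc, div_mul_cancel₀ _ h1]
    ring
  have h4 : poleToZero p z - -(p : ℂ) = z * (1 - p * p) / (1 - p * z) := by
    rw [poleToZero, eq_div_iff h1, sub_mul, div_mul_cancel₀ _ h1]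
    ring
  rw [poleToZero, ofReal_neg, h3, h4, div_div_div_cancel_right₀ h1, mul_div_cancel_right₀ _ h2]

theorem poleToZero_neg_right {p : ℝ} (hp0 : -1 < p) (hp1 : p < 1) {s : ℂ} (hs : ‖s‖ ≤ 1) :
    poleToZero p (poleToZero (-p) s) = s := by
  have := poleToZero_neg_left (p := -p) (by linarith) (by linarith) hs
  rwa [neg_neg] at this

theorem poleToZero_self (p : ℝ) : poleToZero p p = 0 := by simp [poleToZero]

/-! ### Passing between `Co p` and bounded functions. -/

section Transfer

variable {p : ℝ} {f H : ℂ → ℂ}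

theorem toSphere_of_analyticAt {z : ℂ} (h : AnalyticAt ℂ f z) :
    toSphere f z = ((f z : ℂ) : OnePoint ℂ) := by
  rw [toSphere, if_neg (not_lt.mpr h.meromorphicOrderAt_nonneg)]

theorem toSphere_of_neg {z : ℂ} (h : meromorphicOrderAt f z < 0) :
    toSphere f z = OnePoint.infty := by
  rw [toSphere, if_pos h]

theorem poleToZero_ne_zero (hp0 : 0 < p) (hp1 : p < 1) {z : ℂ} (hz : z ∈ ball (0 : ℂ) 1)
    (hzp : z ≠ p) : poleToZero p z ≠ 0 :=
  div_ne_zero (sub_ne_zero.mpr hzp)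
    (one_sub_mul_ne_zero (by linarith) hp1 (by simpa using hz.out.le))

theorem poleToZero_neg_mem (hp0 : 0 < p) (hp1 : p < 1) {s : ℂ} (hs : s ∈ ball (0 : ℂ) 1) :
    poleToZero (-p) s ∈ ball (0 : ℂ) 1 :=
  poleToZero_mem (by linarith) (by linarith) hs

theorem poleToZero_neg_ne (hp0 : 0 < p) (hp1 : p < 1) {s : ℂ} (hs : s ∈ ball (0 : ℂ) 1)
    (hs0 : s ≠ 0) : poleToZero (-p) s ≠ p := by
  intro h
  have := poleToZero_neg_right (p := p) (by linarith) hp1 (by simpa using hs.out.le : ‖s‖ ≤ 1)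
  rw [h, poleToZero_self] at this
  exact hs0 this.symm

theorem eq_of_poleToZero_eq (hp0 : 0 < p) (hp1 : p < 1) {z u : ℂ} (hz : z ∈ ball (0 : ℂ) 1)
    (hu : u ∈ ball (0 : ℂ) 1) (h : poleToZero p z = poleToZero p u) : z = u := by
  have h1 := poleToZero_neg_left (p := p) (by linarith) hp1 (by simpa using hz.out.le : ‖z‖ ≤ 1)
  have h2 := poleToZero_neg_left (p := p) (by linarith) hp1 (by simpa using hu.out.le : ‖u‖ ≤ 1)
  rw [← h1, ← h2, h]

/-- Cross-multiplication expresses equality of H(s)/s and H(t)/t on the sphere: as H(0) ≠ 0, a zero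
s forces t = 0, which accounts for the pole. -/
theorem injOn_toSphere_iff (hp0 : 0 < p) (hp1 : p < 1) (hH0 : H 0 ≠ 0)
    (hf : ∀ z ∈ ball (0 : ℂ) 1, z ≠ p → AnalyticAt ℂ f z) (hpole : meromorphicOrderAt f p < 0)
    (hfH : ∀ z ∈ ball (0 : ℂ) 1, z ≠ p → f z = H (poleToZero p z) / poleToZero p z) :
    InjOn (toSphere f) (ball 0 1) ↔
      ∀ s ∈ ball (0 : ℂ) 1, ∀ t ∈ ball (0 : ℂ) 1, H s * t = H t * s → s = t := by
  constructor
  · intro h s hs t ht hst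
    rcases eq_or_ne s 0 with rfl | hs0
    · rw [mul_zero] at hst
      exact ((mul_eq_zero.mp hst).resolve_left hH0).symm
    rcases eq_or_ne t 0 with rfl | ht0
    · rw [mul_zero, eq_comm] at hst
      exact (mul_eq_zero.mp hst).resolve_left hH0
    have hzs := poleToZero_neg_ne hp0 hp1 hs hs0
    have hzt := poleToZero_neg_ne hp0 hp1 ht ht0
    have hms := poleToZero_neg_mem hp0 hp1 hs
    have hmt := poleToZero_neg_mem hp0 hp1 ht
    have es := poleToZero_neg_right (p := p) (by linarith) hp1 (by simpa using hs.out.le : ‖s‖ ≤ 1)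
    have et := poleToZero_neg_right (p := p) (by linarith) hp1 (by simpa using ht.out.le : ‖t‖ ≤ 1)
    have := h hms hmt (by
      rw [toSphere_of_analyticAt (hf _ hms hzs), toSphere_of_analyticAt (hf _ hmt hzt),
        hfH _ hms hzs, hfH _ hmt hzt, es, et, (div_eq_div_iff hs0 ht0).mpr hst])
    rw [← es, ← et, this]
  · intro h z hz u hu hzu
    rcases eq_or_ne z p with rfl | hzp
    · rcases eq_or_ne u p with rfl | hup
      · rfl
      · rw [toSphere_of_neg hpole, toSphere_of_analyticAt (hf u hu hup)] at hzu
        exact absurd hzu (OnePoint.infty_ne_coe _)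
    · rcases eq_or_ne u p with rfl | hup
      · rw [toSphere_of_neg hpole, toSphere_of_analyticAt (hf z hz hzp)] at hzu
        exact absurd hzu.symm (OnePoint.infty_ne_coe _)
      · rw [toSphere_of_analyticAt (hf z hz hzp), toSphere_of_analyticAt (hf u hu hup),
          OnePoint.coe_eq_coe, hfH z hz hzp, hfH u hu hup,
          div_eq_div_iff (poleToZero_ne_zero hp0 hp1 hz hzp)
            (poleToZero_ne_zero hp0 hp1 hu hup)] at hzu
        exact eq_of_poleToZero_eq hp0 hp1 hz hu
          (h _ (poleToZero_mem (by linarith) hp1 hz) _ (poleToZero_mem (by linarith) hp1 hu) hzu)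

theorem compl_image_toSphere_eq (hp0 : 0 < p) (hp1 : p < 1) (hH0 : H 0 ≠ 0)
    (hf : ∀ z ∈ ball (0 : ℂ) 1, z ≠ p → AnalyticAt ℂ f z) (hpole : meromorphicOrderAt f p < 0)
    (hfH : ∀ z ∈ ball (0 : ℂ) 1, z ≠ p → f z = H (poleToZero p z) / poleToZero p z) :
    {w : ℂ | (w : OnePoint ℂ) ∉ toSphere f '' ball (0 : ℂ) 1} = omitted H := by
  ext w
  simp only [mem_ofPred_eq, omitted, mem_image, not_exists, not_and]
  constructor
  · intro h s hs hcon
    have hs0 : s ≠ 0 := by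
      rintro rfl
      rw [mul_zero] at hcon
      exact hH0 hcon
    have hzs := poleToZero_neg_ne hp0 hp1 hs hs0
    have hms := poleToZero_neg_mem hp0 hp1 hs
    have es := poleToZero_neg_right (p := p) (by linarith) hp1 (by simpa using hs.out.le : ‖s‖ ≤ 1)
    refine h _ hms ?_
    rw [toSphere_of_analyticAt (hf _ hms hzs), hfH _ hms hzs, es, hcon, mul_div_cancel_right₀ _ hs0]
  · intro h z hz hcon
    rcases eq_or_ne z p with rfl | hzp
    · rw [toSphere_of_neg hpole] at hcon
      exact OnePoint.infty_ne_coe _ hcon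
    · rw [toSphere_of_analyticAt (hf z hz hzp), OnePoint.coe_eq_coe, hfH z hz hzp,
        div_eq_iff (poleToZero_ne_zero hp0 hp1 hz hzp)] at hcon
      exact h _ (poleToZero_mem (by linarith) hp1 hz) hcon

/-- The pole of a function that is injective as a map to the sphere is simple. -/
theorem exists_simple_pole (hp0 : 0 < p) (hp1 : p < 1) (hmer : MeromorphicAt f p)
    (hf : ∀ z ∈ ball (0 : ℂ) 1, z ≠ p → AnalyticAt ℂ f z) (hpole : meromorphicOrderAt f p < 0)
    (hinj : InjOn (toSphere f) (ball 0 1)) :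
    ∃ g : ℂ → ℂ, AnalyticAt ℂ g p ∧ g p ≠ 0 ∧ ∀ᶠ z in 𝓝[≠] (p : ℂ), (z - p) * f z = g z := by
  have hpb : (p : ℂ) ∈ ball (0 : ℂ) 1 := by
    rw [mem_ball_zero_iff, norm_real, Real.norm_of_nonneg hp0.le]; exact hp1
  obtain ⟨n, hn⟩ := WithTop.ne_top_iff_exists.mp (ne_top_of_lt hpole)
  obtain ⟨g, hg, hg0, hev⟩ := (meromorphicOrderAt_eq_int_iff hmer).mp hn.symm
  have hn0 : n < 0 := by
    rw [← hn] at hpole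
    exact_mod_cast hpole
  obtain ⟨m, hm⟩ : ∃ m : ℕ, n = -(m : ℤ) := ⟨n.natAbs, by omega⟩
  have hm0 : m ≠ 0 := by omega
  have hev' : ∀ᶠ z : ℂ in 𝓝 (p : ℂ), z ≠ p → (z - p) ^ m * f z = g z := by
    rw [eventually_nhdsWithin_iff] at hev
    filter_upwards [hev] with z hz hzp
    rw [hz hzp, hm, zpow_neg, zpow_natCast, smul_eq_mul,
      mul_inv_cancel_left₀ (pow_ne_zero m (sub_ne_zero.mpr hzp))]
  -- Near p this is 1/f, with a zero of order m; it inherits injectivity, so its derivative at p is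
  -- nonzero and m = 1.
  set i : ℂ → ℂ := fun z => (z - p) ^ m * (g z)⁻¹ with hi
  have hian : AnalyticAt ℂ i p := ((analyticAt_id.sub analyticAt_const).pow m).mul (hg.inv hg0)
  have hU := inter_mem (inter_mem hev' (hg.continuousAt.eventually_ne hg0))
    (isOpen_ball.mem_nhds hpb)
  have hii : InjOn i ({x | (fun z : ℂ => z ≠ p → (z - p) ^ m * f z = g z) x} ∩
      {x | (fun z => g z ≠ 0) x} ∩ ball 0 1) := by
    intro z hz u hu hzu
    obtain ⟨⟨hz1, hz2⟩, hz3⟩ := hz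
    obtain ⟨⟨hu1, hu2⟩, hu3⟩ := hu
    change z ≠ p → (z - p) ^ m * f z = g z at hz1
    change u ≠ p → (u - p) ^ m * f u = g u at hu1
    change g z ≠ 0 at hz2
    change g u ≠ 0 at hu2
    have hip : ∀ w, g w ≠ 0 → i w = 0 → w = p := by
      intro w hw h
      simp only [hi] at h
      exact sub_eq_zero.mp (eq_zero_of_pow_eq_zero
        ((mul_eq_zero.mp h).resolve_right (inv_ne_zero hw)))
    have hip0 : i p = 0 := by simp [hi, hm0]
    rcases eq_or_ne z p with rfl | hzp
    · exact (hip u hu2 (by rw [← hzu, hip0])).symm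
    rcases eq_or_ne u p with rfl | hup
    · exact hip z hz2 (by rw [hzu, hip0])
    have hfi : ∀ w, g w ≠ 0 → w ≠ p → (w - p) ^ m * f w = g w → f w = (i w)⁻¹ := by
      intro w hw hwp h
      have := pow_ne_zero m (sub_ne_zero.mpr hwp)
      simp only [hi, mul_inv, inv_inv]
      rw [← h, inv_mul_cancel_left₀ this]
    refine hinj hz3 hu3 ?_
    rw [toSphere_of_analyticAt (hf z hz3 hzp), toSphere_of_analyticAt (hf u hu3 hup),
      hfi z hz2 hzp (hz1 hzp), hfi u hu2 hup (hu1 hup), hzu]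
  have hd := deriv_ne_zero_of_injOn hian hU hii
  have hm1 : m = 1 := by
    by_contra hne
    apply hd
    have h1 : HasDerivAt i _ p := (((hasDerivAt_id (p : ℂ)).sub_const (p : ℂ)).pow m).mul
      (hg.inv hg0).differentiableAt.hasDerivAt
    rw [h1.deriv]
    have hm2 : m - 1 ≠ 0 := by omega
    simp [hm0, hm2]
  refine ⟨g, hg, hg0, ?_⟩
  rw [eventually_nhdsWithin_iff]
  filter_upwards [hev'] with z hz hzp
  have := hz hzp
  rwa [hm1, pow_one] at this

theorem exists_of_mem_Co (hp0 : 0 < p) (hp1 : p < 1) (hfc : f ∈ Co p) :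
    ∃ H : ℂ → ℂ, DifferentiableOn ℂ H (ball 0 1) ∧ H 0 ≠ 0 ∧
      (∀ s ∈ ball (0 : ℂ) 1, ∀ t ∈ ball (0 : ℂ) 1, H s * t = H t * s → s = t) ∧
      Convex ℝ (omitted H) ∧ f =ᶠ[𝓝 0] fun z => H (poleToZero p z) / poleToZero p z := by
  obtain ⟨⟨hmer, hinj, hconv⟩, hpole, -, -⟩ := hfc
  have hpb : (p : ℂ) ∈ ball (0 : ℂ) 1 := by
    rw [mem_ball_zero_iff, norm_real, Real.norm_of_nonneg hp0.le]; exact hp1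
  have hf : ∀ z ∈ ball (0 : ℂ) 1, z ≠ p → AnalyticAt ℂ f z := by
    intro z hz hzp
    -- A second pole would also be sent to ∞, against injectivity.
    rw [← (hmer hz).meromorphicOrderAt_nonneg_iff_analyticAt]
    by_contra! hlt
    exact hzp (hinj hz hpb (by rw [toSphere_of_neg hlt, toSphere_of_neg hpole]))
  obtain ⟨g, hg, hg0, hev⟩ := exists_simple_pole hp0 hp1 (hmer hpb).meromorphicAt hf hpole hinj
  classical
  set F : ℂ → ℂ := fun z => if z = p then g p else (z - p) * f z with hF
  have hFan : ∀ z ∈ ball (0 : ℂ) 1, AnalyticAt ℂ F z := by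
    intro z hz
    rcases eq_or_ne z p with rfl | hzp
    · refine hg.congr ?_
      rw [eventually_nhdsWithin_iff] at hev
      filter_upwards [hev] with u hu
      rcases eq_or_ne u p with rfl | hup
      · simp [hF]
      · simp only [hF, if_neg hup]
        exact (hu hup).symm
    · have h1 : AnalyticAt ℂ (fun z => (z - p) * f z) z :=
        (analyticAt_id.sub analyticAt_const).mul (hf z hz hzp)
      refine h1.congr ?_
      filter_upwards [isOpen_compl_singleton.mem_nhds hzp] with u hu
      have : u ≠ p := hu
      simp [hF, this]
  set H : ℂ → ℂ := fun s => F (poleToZero (-p) s) / (1 - p * poleToZero (-p) s) with hHdef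
  have hden : ∀ s ∈ ball (0 : ℂ) 1, 1 - (p : ℂ) * poleToZero (-p) s ≠ 0 := fun s hs =>
    one_sub_mul_ne_zero (by linarith) hp1 (by simpa using (poleToZero_neg_mem hp0 hp1 hs).out.le)
  have hTd : DifferentiableOn ℂ (poleToZero (-p)) (ball 0 1) := fun s hs =>
    (hasDerivAt_poleToZero (by linarith) (by linarith)
      (by simpa using hs.out.le)).differentiableAt.differentiableWithinAt
  have hH : DifferentiableOn ℂ H (ball 0 1) := by
    refine DifferentiableOn.div ?_ ((differentiableOn_const _).sub (hTd.const_mul _)) hden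
    exact DifferentiableOn.comp (t := ball 0 1)
      (fun z hz => (hFan z hz).differentiableAt.differentiableWithinAt) hTd
      fun s hs => poleToZero_neg_mem hp0 hp1 hs
  have hH0 : H 0 ≠ 0 := by
    have h1 := hden 0 (by simp)
    have h2 : poleToZero (-p) 0 = p := by simp [poleToZero]
    simp only [hHdef, h2] at h1 ⊢
    simp only [hF, if_true]
    exact div_ne_zero hg0 h1
  have hfH : ∀ z ∈ ball (0 : ℂ) 1, z ≠ p → f z = H (poleToZero p z) / poleToZero p z := by
    intro z hz hzp
    have hz1 : ‖z‖ ≤ 1 := by simpa using hz.out.le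
    have h1 := poleToZero_neg_left (p := p) (by linarith) hp1 hz1
    have h2 := one_sub_mul_ne_zero (p := p) (by linarith) hp1 hz1
    simp only [hHdef, h1, hF, if_neg hzp]
    rw [poleToZero, div_div_div_cancel_right₀ h2, mul_div_cancel_left₀ _ (sub_ne_zero.mpr hzp)]
  refine ⟨H, hH, hH0, (injOn_toSphere_iff hp0 hp1 hH0 hf hpole hfH).mp hinj, ?_, ?_⟩
  · rw [← compl_image_toSphere_eq hp0 hp1 hH0 hf hpole hfH]
    exact hconv
  · have hp0' : (0 : ℂ) ≠ p := fun h => hp0.ne (by exact_mod_cast h)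
    filter_upwards [isOpen_ball.mem_nhds (by simp : (0 : ℂ) ∈ ball (0 : ℂ) 1),
      isOpen_compl_singleton.mem_nhds hp0'] with z hz hzp
    exact hfH z hz hzp

theorem exists_mem_Co (hp0 : 0 < p) (hp1 : p < 1) {ψ : ℂ → ℂ}
    (hψ : DifferentiableOn ℂ ψ (ball 0 1)) (hb : ∀ s ∈ ball (0 : ℂ) 1, ‖ψ s‖ ≤ 1) :
    ∃ f ∈ Co p, feketeSzego 1 f = (-(1 - (p : ℂ) ^ 2) ^ 2 * ψ (poleToZero p 0) +
      p * (1 - (p : ℂ) ^ 2) / 3 * deriv (fun z => ψ (poleToZero p z)) 0) /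
        (1 - (p : ℂ) ^ 2 * ψ (poleToZero p 0)) ^ 2 := by
  have hp2 : -1 < p := by linarith
  have hpc : (p : ℂ) ≠ 0 := ofReal_ne_zero.mpr hp0.ne'
  have hpb : (p : ℂ) ∈ ball (0 : ℂ) 1 := by
    rw [mem_ball_zero_iff, norm_real, Real.norm_of_nonneg hp0.le]; exact hp1
  have h0b : (0 : ℂ) ∈ ball (0 : ℂ) 1 := by simp
  have hpp : (1 : ℂ) - p ^ 2 ≠ 0 := by
    have := one_sub_mul_ne_zero (p := p) hp2 hp1 (z := p) (by simpa using hpb.out.le)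
    rwa [← sq] at this
  obtain ⟨H, κ, hH, hκ, hH0, hHa, hka, hk, hN, hode⟩ := exists_of_bounded hψ hb
    -- With a = -p, the value c = -p²/(1 - p²) is the one that makes f'(0) = 1, and H(a) = 0 gives
    -- f(0) = 0.
    (a := poleToZero p 0) (c := -(p : ℂ) ^ 2 / (1 - p ^ 2)) (poleToZero_mem hp2 hp1 h0b)
    (by rw [poleToZero_zero]; exact neg_ne_zero.mpr hpc)
    (div_ne_zero (neg_ne_zero.mpr (pow_ne_zero 2 hpc)) hpp)
  classical
  -- The value 0 at the pole is what meromorphic normal form requires.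
  set f : ℂ → ℂ := fun z => if z = p then 0 else H (poleToZero p z) / poleToZero p z with hfdef
  have hfH : ∀ z ∈ ball (0 : ℂ) 1, z ≠ p → f z = H (poleToZero p z) / poleToZero p z :=
    fun z _ hzp => by simp only [hfdef, if_neg hzp]
  have hev : ∀ z : ℂ, z ≠ p → f =ᶠ[𝓝 z] fun z => H (poleToZero p z) / poleToZero p z := by
    intro z hzp
    filter_upwards [isOpen_compl_singleton.mem_nhds hzp] with u hu
    have : u ≠ p := hu
    simp only [hfdef, if_neg this]
  have hTan : ∀ z ∈ ball (0 : ℂ) 1, AnalyticAt ℂ (poleToZero p) z := fun z hz =>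
    DifferentiableOn.analyticAt (s := ball 0 1) (fun u hu => (hasDerivAt_poleToZero hp2 hp1
      (by simpa using hu.out.le)).differentiableAt.differentiableWithinAt) (isOpen_ball.mem_nhds hz)
  have hf : ∀ z ∈ ball (0 : ℂ) 1, z ≠ p → AnalyticAt ℂ f z := by
    intro z hz hzp
    refine AnalyticAt.congr ?_ (hev z hzp).symm
    exact AnalyticAt.fun_comp (f := poleToZero p) (analyticAt_div_self hH (poleToZero_mem hp2 hp1 hz)
      (poleToZero_ne_zero hp0 hp1 hz hzp)) (hTan z hz)
  set g : ℂ → ℂ := fun z => H (poleToZero p z) * (1 - p * z) with hg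
  have hgan : AnalyticAt ℂ g p := by
    refine AnalyticAt.mul (AnalyticAt.fun_comp (f := poleToZero p) ?_ (hTan p hpb)) (by fun_prop)
    exact hH.analyticAt (isOpen_ball.mem_nhds (poleToZero_mem hp2 hp1 hpb))
  have hgp : g p ≠ 0 := by
    simp only [hg, poleToZero_self, ← sq]
    exact mul_ne_zero hH0 hpp
  have hfg : f =ᶠ[𝓝 (p : ℂ)] (· - (p : ℂ)) ^ (-1 : ℤ) • g := by
    filter_upwards [isOpen_ball.mem_nhds hpb] with z hz
    have h2 := one_sub_mul_ne_zero hp2 hp1 (by simpa using hz.out.le : ‖z‖ ≤ 1)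
    rcases eq_or_ne z p with rfl | hzp
    · simp [hfdef]
    · change _ = (z - (p : ℂ)) ^ (-1 : ℤ) * (H (poleToZero p z) * (1 - p * z))
      simp only [hfdef, if_neg hzp, zpow_neg_one]
      generalize H (poleToZero p z) = x
      rw [poleToZero]
      rw [div_div_eq_mul_div]
      ring
  have hNFp : MeromorphicNFAt f p := Or.inr ⟨-1, g, hgan, hgp, hfg⟩
  have hord : meromorphicOrderAt f p = ((-1 : ℤ) : WithTop ℤ) :=
    (meromorphicOrderAt_eq_int_iff hNFp.meromorphicAt).mpr
      ⟨g, hgan, hgp, eventually_nhdsWithin_of_eventually_nhds hfg⟩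
  have hpole : meromorphicOrderAt f p < 0 := by
    rw [hord]
    exact_mod_cast (by norm_num : (-1 : ℤ) < 0)
  have h0p : (0 : ℂ) ≠ p := hpc.symm
  have hf1 : deriv f 0 = 1 := by
    have h1 := (hasDerivAt_div_self hH (poleToZero_mem hp2 hp1 h0b)
      (poleToZero_ne_zero hp0 hp1 h0b h0p)).comp (0 : ℂ)
      (hasDerivAt_poleToZero hp2 hp1 (by simp))
    have h2 : deriv (fun z => H (poleToZero p z) / poleToZero p z) 0 = _ := h1.deriv
    rw [(hev 0 h0p).deriv_eq, h2, hka, poleToZero_zero]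
    field_simp
    simp
  refine ⟨f, ⟨⟨?_, ?_, ?_⟩, hpole, ?_, hf1⟩, ?_⟩
  · intro z hz
    rcases eq_or_ne z p with rfl | hzp
    · exact hNFp
    · exact (hf z hz hzp).meromorphicNFAt
  · exact (injOn_toSphere_iff hp0 hp1 hH0 hf hpole hfH).mpr (injective_of_exp hH hH0 hκ hk hN)
  · rw [compl_image_toSphere_eq hp0 hp1 hH0 hf hpole hfH]
    exact convex_omitted_of_exp hH hH0 hκ hk hN
  · rw [hfH 0 h0b h0p, hHa, zero_div]
  · exact feketeSzego_eq_of_ode hp0 hp1 hH hψ hb hode (hev 0 h0p) hf1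

/-- Every value of the functional comes from a bounded function. -/
theorem exists_bounded_of_mem_Co (hp0 : 0 < p) (hp1 : p < 1) (hfc : f ∈ Co p) :
    ∃ b b₁ : ℂ, ‖b‖ ≤ 1 ∧ ‖b₁‖ ≤ 1 - ‖b‖ ^ 2 ∧ feketeSzego 1 f =
      (-(1 - (p : ℂ) ^ 2) ^ 2 * b + p * (1 - (p : ℂ) ^ 2) / 3 * b₁) /
        (1 - (p : ℂ) ^ 2 * b) ^ 2 := by
  obtain ⟨H, hH, hH0, hinj, hconv, hfH⟩ := exists_of_mem_Co hp0 hp1 hfc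
  have hp2 : -1 < p := by linarith
  have h0b : (0 : ℂ) ∈ ball (0 : ℂ) 1 := by simp
  have hk : ∀ s ∈ ball (0 : ℂ) 1, H s - s * deriv H s ≠ 0 := fun s hs =>
    sub_mul_deriv_ne_zero hH hH0 hinj hs
  have hH' : DifferentiableOn ℂ (deriv H) (ball 0 1) := hH.deriv isOpen_ball
  have hH'' : DifferentiableOn ℂ (deriv (deriv H)) (ball 0 1) := hH'.deriv isOpen_ball
  -- M = (H - sH')(c + 1) with c = `curvature H s`, so H''/M is (c - 1)/(c + 1) already divided by
  -- s², with no singularity at 0.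
  set M : ℂ → ℂ := fun s => 2 * (H s - s * deriv H s) + s ^ 2 * deriv (deriv H) s with hM
  have hMc : ∀ s ∈ ball (0 : ℂ) 1, M s = (H s - s * deriv H s) * (curvature H s + 1) := by
    intro s hs
    have := hk s hs
    simp only [hM, curvature]
    field_simp
    ring
  have hre : ∀ s ∈ ball (0 : ℂ) 1, 0 ≤ (curvature H s).re := fun s hs =>
    re_curvature_nonneg hH hH0 hinj hconv hs
  have hcne : ∀ s ∈ ball (0 : ℂ) 1, curvature H s + 1 ≠ 0 := by
    intro s hs h
    have := congrArg re h
    simp at this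
    linarith [hre s hs]
  have hM0 : ∀ s ∈ ball (0 : ℂ) 1, M s ≠ 0 := fun s hs => by
    rw [hMc s hs]; exact mul_ne_zero (hk s hs) (hcne s hs)
  set ψ : ℂ → ℂ := fun s => deriv (deriv H) s / M s with hψdef
  have hψ : DifferentiableOn ℂ ψ (ball 0 1) := by
    refine hH''.div ?_ hM0
    exact ((hH.sub (differentiableOn_id.mul hH')).const_mul 2).add ((differentiableOn_id.pow 2).mul hH'')
  have hb : ∀ s ∈ ball (0 : ℂ) 1, ‖ψ s‖ ≤ 1 := by
    refine fun s hs => norm_le_one_of_norm_sq_mul_le_one hψ (fun s hs => ?_) hs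
    have h1 : s ^ 2 * ψ s = (curvature H s - 1) / (curvature H s + 1) := by
      have h2 : s ^ 2 * deriv (deriv H) s = (H s - s * deriv H s) * (curvature H s - 1) := by
        have := hk s hs
        simp only [curvature]
        field_simp
        ring
      simp only [hψdef]
      rw [mul_div_assoc', h2, hMc s hs, mul_div_mul_left _ _ (hk s hs)]
    rw [h1, norm_div, div_le_one (norm_pos_iff.mpr (hcne s hs))]
    refine (sq_le_sq₀ (norm_nonneg _) (norm_nonneg _)).mp ?_
    rw [Complex.sq_norm, Complex.sq_norm, normSq_apply, normSq_apply]
    simp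
    nlinarith [hre s hs]
  have hode : ∀ s ∈ ball (0 : ℂ) 1,
      deriv (deriv H) s * (1 - s ^ 2 * ψ s) = 2 * (H s - s * deriv H s) * ψ s := by
    intro s hs
    have h1 : ψ s * M s = deriv (deriv H) s := div_mul_cancel₀ _ (hM0 s hs)
    have h2 : M s = 2 * (H s - s * deriv H s) + s ^ 2 * deriv (deriv H) s := rfl
    linear_combination ψ s * h2 - h1
  have hχd : DifferentiableOn ℂ (fun z => ψ (poleToZero p z)) (ball 0 1) :=
    hψ.comp (fun z hz => (hasDerivAt_poleToZero hp2 hp1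
      (by simpa using hz.out.le)).differentiableAt.differentiableWithinAt)
      fun z hz => poleToZero_mem hp2 hp1 hz
  have hχb : ∀ z ∈ ball (0 : ℂ) 1, ‖ψ (poleToZero p z)‖ ≤ 1 := fun z hz =>
    hb _ (poleToZero_mem hp2 hp1 hz)
  exact ⟨_, _, hχb 0 h0b, norm_deriv_zero_le hχd hχb,
    feketeSzego_eq_of_ode hp0 hp1 hH hψ hb hode hfH hfc.2.2.2⟩

end Transfer

/-! ### The Koebe region. -/

/-- The image of a disk of radius `q < 1` under the Koebe function, as the exterior of an ellipse in
the variable `1 / k`. -/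
theorem exists_koebe_eq_iff {q : ℝ} (hq0 : 0 < q) (hq1 : q < 1) (k : ℂ) :
    (∃ v : ℂ, ‖v‖ ≤ q ∧ koebe v = k) ↔ 2 * (1 + q ^ 2) * ‖k‖ ≤ q * (1 + ‖1 + 4 * k‖) := by
  -- From v = k(1 - v)² and (1 + v)² = (1 + 4k)(1 - v)² with the parallelogram law, the stated
  -- inequality becomes (q - |v|)(1 - q|v|) ≥ 0.
  have key : ∀ v : ℂ, v ≠ 1 → koebe v = k →
      ‖v‖ = ‖k‖ * ‖1 - v‖ ^ 2 ∧ ‖1 - v‖ ^ 2 * (1 + ‖1 + 4 * k‖) = 2 + 2 * ‖v‖ ^ 2 := by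
    intro v hv hk
    have h1 : (1 : ℂ) - v ≠ 0 := sub_ne_zero.mpr hv.symm
    have h2 : v = k * (1 - v) ^ 2 := by
      rw [← hk, koebe, div_mul_cancel₀ _ (pow_ne_zero 2 h1)]
    have h3 : (1 - v) ^ 2 * (1 + 4 * k) = (1 + v) ^ 2 := by linear_combination -4 * h2
    refine ⟨?_, ?_⟩
    · have := congrArg norm h2
      rwa [norm_mul, norm_pow] at this
    · have h4 := congrArg norm h3
      rw [norm_mul, norm_pow, norm_pow] at h4
      rw [mul_add, mul_one, h4]
      simp only [Complex.sq_norm, normSq_apply]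
      simp
      ring
  constructor
  · rintro ⟨v, hv, hk⟩
    have hv1 : v ≠ 1 := by
      rintro rfl
      rw [norm_one] at hv
      linarith
    obtain ⟨h1, h2⟩ := key v hv1 hk
    have hpos : 0 < ‖1 - v‖ ^ 2 := by
      have := norm_pos_iff.mpr (sub_ne_zero.mpr hv1.symm)
      positivity
    refine le_of_mul_le_mul_left ?_ hpos
    have : 0 ≤ (q - ‖v‖) * (1 - q * ‖v‖) := by
      apply mul_nonneg <;> nlinarith [norm_nonneg v]
    nlinarith
  · intro h
    rcases eq_or_ne k 0 with rfl | hk0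
    · exact ⟨0, by simpa using hq0.le, by simp [koebe]⟩
    obtain ⟨d, hd⟩ := IsAlgClosed.exists_pow_nat_eq (1 + 4 * k) two_pos
    have hroot : ∀ e : ℂ, e ^ 2 = 1 + 4 * k → (2 * k + 1 + e) / (2 * k) ≠ 1 ∧
        koebe ((2 * k + 1 + e) / (2 * k)) = k := by
      intro e he
      set v := (2 * k + 1 + e) / (2 * k) with hv
      have hev : v = k * (1 - v) ^ 2 := by
        rw [hv]
        field_simp
        linear_combination (-1 : ℂ) * he
      have hv1 : v ≠ 1 := by
        intro h
        rw [h] at hev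
        simp at hev
      refine ⟨hv1, ?_⟩
      rw [koebe, div_eq_iff (pow_ne_zero 2 (sub_ne_zero.mpr hv1.symm))]
      exact hev
    -- The two solutions of K(v) = k are reciprocal, so one of them lies in the closed unit disk.
    have hprod : (2 * k + 1 + d) / (2 * k) * ((2 * k + 1 + -d) / (2 * k)) = 1 := by
      field_simp
      linear_combination (-1 : ℂ) * hd
    obtain ⟨v, hv, hv1, hk⟩ : ∃ v : ℂ, ‖v‖ ≤ 1 ∧ v ≠ 1 ∧ koebe v = k := by
      have hn := congrArg norm hprod
      rw [norm_mul, norm_one] at hn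
      rcases le_or_gt ‖(2 * k + 1 + d) / (2 * k)‖ 1 with hle | hgt
      · exact ⟨_, hle, hroot d hd⟩
      · refine ⟨_, ?_, hroot (-d) (by rw [neg_sq, hd])⟩
        nlinarith [norm_nonneg ((2 * k + 1 + -d) / (2 * k))]
    obtain ⟨h1, h2⟩ := key v hv1 hk
    refine ⟨v, ?_, hk⟩
    by_contra! hlt
    have hpos : 0 < ‖1 - v‖ ^ 2 := by
      have := norm_pos_iff.mpr (sub_ne_zero.mpr hv1.symm)
      positivity
    have h3 := mul_le_mul_of_nonneg_left h hpos.le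
    have : 0 < (‖v‖ - q) * (1 - q * ‖v‖) := by
      apply mul_pos <;> nlinarith [norm_nonneg v]
    nlinarith

theorem bigP_sq_sub_four {p : ℝ} (hp0 : 0 < p) : bigP p ^ 2 - 4 = (1 - p ^ 2) ^ 2 / p ^ 2 := by
  rw [bigP]
  field_simp
  ring

theorem mem_koebeRegion_iff {p : ℝ} (hp0 : 0 < p) (hp1 : p < 1) (w : ℂ) :
    w ∈ koebeRegion p ↔ ∃ v : ℂ, ‖v‖ ≤ p ^ 2 ∧ koebe v = -(p ^ 2 / (1 - p ^ 2) ^ 2 : ℝ) * w := by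
  have hA : ((bigP p : ℂ) ^ 2 - 4) = (((1 - p ^ 2) ^ 2 / p ^ 2 : ℝ) : ℂ) := by
    rw [← bigP_sq_sub_four hp0]
    push_cast
    ring
  have hp2 : (1 - p ^ 2 : ℝ) ≠ 0 := by nlinarith
  have hinv : ((p ^ 2 / (1 - p ^ 2) ^ 2 : ℝ) : ℂ) * (((1 - p ^ 2) ^ 2 / p ^ 2 : ℝ) : ℂ) = 1 := by
    rw [← ofReal_mul]
    have : p ^ 2 / (1 - p ^ 2) ^ 2 * ((1 - p ^ 2) ^ 2 / p ^ 2) = 1 := by field_simp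
    rw [this, ofReal_one]
  simp only [koebeRegion, mem_image, mem_closedBall_zero_iff, hA]
  constructor
  · rintro ⟨z, hz, rfl⟩
    refine ⟨(p : ℂ) ^ 2 * (starRingEnd ℂ) z, ?_, ?_⟩
    · rw [norm_mul, norm_pow, norm_real, RCLike.norm_conj, Real.norm_of_nonneg hp0.le]
      nlinarith [sq_nonneg p]
    · linear_combination (-koebe ((p : ℂ) ^ 2 * (starRingEnd ℂ) z)) * hinv
  · rintro ⟨v, hv, hk⟩
    have hpc : (p : ℂ) ≠ 0 := ofReal_ne_zero.mpr hp0.ne'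
    refine ⟨(starRingEnd ℂ) (v / (p : ℂ) ^ 2), ?_, ?_⟩
    · rw [RCLike.norm_conj, norm_div, norm_pow, norm_real, Real.norm_of_nonneg hp0.le]
      exact div_le_one_of_le₀ hv (by positivity)
    · rw [conj_conj, mul_div_cancel₀ _ (pow_ne_zero 2 hpc), hk]
      linear_combination w * hinv

/-- A constant ψ = z̄ has b₁ = 0, and P² - 4 = (1 - p²)²/p² turns the formula into the Koebe
expression. -/
theorem koebeRegion_subset {p : ℝ} (hp0 : 0 < p) (hp1 : p < 1) :
    koebeRegion p ⊆ variabilityRegion p := by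
  rintro _ ⟨z, hz, rfl⟩
  rw [mem_closedBall_zero_iff] at hz
  obtain ⟨f, hf, hfs⟩ := exists_mem_Co hp0 hp1 (ψ := fun _ => (starRingEnd ℂ) z)
    (differentiableOn_const _) (fun _ _ => by rwa [RCLike.norm_conj])
  refine ⟨f, hf, ?_⟩
  rw [hfs]
  have hpc : (p : ℂ) ≠ 0 := ofReal_ne_zero.mpr hp0.ne'
  have hA : ((bigP p : ℂ) ^ 2 - 4) = (1 - (p : ℂ) ^ 2) ^ 2 / (p : ℂ) ^ 2 := by
    have := congrArg (fun x : ℝ => (x : ℂ)) (bigP_sq_sub_four hp0)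
    push_cast at this
    exact this
  simp only [hA, koebe, deriv_const]
  field_simp
  ring

/-! ### Estimates of the variability region. -/

theorem norm_le_one_sub_mul {p : ℝ} (hp0 : 0 < p) (hp1 : p < 1) {b : ℂ} (hb : ‖b‖ ≤ 1) :
    0 < 1 - p ^ 2 * ‖b‖ ∧ 1 - p ^ 2 * ‖b‖ ≤ ‖1 - (p : ℂ) ^ 2 * b‖ := by
  have h1 := norm_sub_norm_le (1 : ℂ) ((p : ℂ) ^ 2 * b)
  rw [norm_one, norm_mul, norm_pow, norm_real, Real.norm_of_nonneg hp0.le] at h1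
  have : p ^ 2 < 1 := by nlinarith
  exact ⟨by nlinarith [norm_nonneg b], h1⟩

theorem variabilityRegion_subset_closedBall {p : ℝ} (hp0 : 0 < p) (hp1 : p < 1) :
    variabilityRegion p ⊆ closedBall 0 1 := by
  rintro _ ⟨f, hf, rfl⟩
  obtain ⟨b, b₁, hb, hb₁, hfs⟩ := exists_bounded_of_mem_Co hp0 hp1 hf
  rw [hfs, mem_closedBall_zero_iff]
  obtain ⟨hpos, hle⟩ := norm_le_one_sub_mul hp0 hp1 hb
  rw [norm_div, norm_pow, div_le_one (by have := hpos.trans_le hle; positivity)]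
  have hq : 0 < 1 - p ^ 2 := by nlinarith
  have hq1 : ‖1 - (p : ℂ) ^ 2‖ = 1 - p ^ 2 := by
    rw [show 1 - (p : ℂ) ^ 2 = ((1 - p ^ 2 : ℝ) : ℂ) by push_cast; ring, norm_real,
      Real.norm_of_nonneg hq.le]
  have h1 : ‖-(1 - (p : ℂ) ^ 2) ^ 2 * b + p * (1 - (p : ℂ) ^ 2) / 3 * b₁‖ ≤
      (1 - p ^ 2) ^ 2 * ‖b‖ + p * (1 - p ^ 2) / 3 * ‖b₁‖ := by
    refine (norm_add_le _ _).trans (le_of_eq ?_)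
    rw [norm_mul, norm_mul, norm_neg, norm_pow, norm_div, norm_mul, hq1, norm_real,
      Real.norm_of_nonneg hp0.le]
    norm_num
  have h2 : (1 - p ^ 2 * ‖b‖) ^ 2 ≤ ‖1 - (p : ℂ) ^ 2 * b‖ ^ 2 := pow_le_pow_left₀ hpos.le hle 2
  refine h1.trans (le_trans ?_ h2)
  set r := ‖b‖
  have hr : 0 ≤ r := norm_nonneg b
  have h3 : p * (1 - p ^ 2) / 3 * ‖b₁‖ ≤ p * (1 - p ^ 2) / 3 * (1 - r ^ 2) :=
    mul_le_mul_of_nonneg_left hb₁ (by positivity)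
  -- The factor 1 - r comes out because the bound is attained as r = 1; the remaining factor is at
  -- least (1 - p²)(1 + p² - 2p/3) > 0.
  have h4 : (1 - p ^ 2 * r) ^ 2 - (1 - p ^ 2) ^ 2 * r - p * (1 - p ^ 2) / 3 * (1 - r ^ 2) =
      (1 - r) * (1 - p ^ 4 * r - p * (1 - p ^ 2) / 3 * (1 + r)) := by ring
  have h5 : 0 ≤ 1 - p ^ 4 * r - p * (1 - p ^ 2) / 3 * (1 + r) := by
    have e1 : p ^ 4 * r ≤ p ^ 4 := by nlinarith [pow_pos hp0 4]
    have e2 : p * (1 - p ^ 2) / 3 * (1 + r) ≤ p * (1 - p ^ 2) / 3 * 2 :=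
      mul_le_mul_of_nonneg_left (by linarith) (by positivity)
    nlinarith [mul_pos hp0 hq, mul_pos hq hq]
  have h6 : 0 ≤ (1 - r) * (1 - p ^ 4 * r - p * (1 - p ^ 2) / 3 * (1 + r)) :=
    mul_nonneg (by linarith) h5
  linarith

/-- Put u = p²b and let σ be the contribution of b₁, so that k(1 - u)² = u + σ. Multiplying the
criterion of `exists_koebe_eq_iff` with q = p² by |1 - u|² and using the triangle inequality twice
leaves (1 + p²)²|σ| ≤ p²(1 - r)(1 - p⁴r). -/
theorem variabilityRegion_subset_koebeRegion {p : ℝ} (hp0 : 0 < p) (hp1 : p < 1)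
    (hp : 2 * p * (1 + p ^ 2) ≤ 3 * (1 - p ^ 2) ^ 2) :
    variabilityRegion p ⊆ koebeRegion p := by
  rintro _ ⟨f, hf, rfl⟩
  obtain ⟨b, b₁, hb, hb₁, hfs⟩ := exists_bounded_of_mem_Co hp0 hp1 hf
  have hq : 0 < 1 - p ^ 2 := by nlinarith
  have hqc : (1 : ℂ) - (p : ℂ) ^ 2 ≠ 0 := by
    rw [show 1 - (p : ℂ) ^ 2 = ((1 - p ^ 2 : ℝ) : ℂ) by push_cast; ring]
    exact ofReal_ne_zero.mpr hq.ne'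
  obtain ⟨hpos, hle⟩ := norm_le_one_sub_mul hp0 hp1 hb
  have hpos' := hpos.trans_le hle
  rw [hfs, mem_koebeRegion_iff hp0 hp1,
    exists_koebe_eq_iff (by positivity : 0 < p ^ 2) (by nlinarith)]
  set u : ℂ := (p : ℂ) ^ 2 * b with hu
  have hune : 1 - u ≠ 0 := norm_pos_iff.mp hpos'
  set σ : ℂ := -((p ^ 3 / (3 * (1 - p ^ 2)) : ℝ) : ℂ) * b₁ with hσ
  set k : ℂ := -((p ^ 2 / (1 - p ^ 2) ^ 2 : ℝ) : ℂ) *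
    ((-(1 - (p : ℂ) ^ 2) ^ 2 * b + p * (1 - (p : ℂ) ^ 2) / 3 * b₁) / (1 - u) ^ 2) with hk
  have hku : k * (1 - u) ^ 2 = u + σ := by
    rw [hk, mul_assoc, div_mul_cancel₀ _ (pow_ne_zero 2 hune), hu, hσ]
    push_cast
    field_simp
    ring
  have hk4 : (1 + 4 * k) * (1 - u) ^ 2 = (1 + u) ^ 2 + 4 * σ := by linear_combination 4 * hku
  have hn1 : ‖k‖ * ‖1 - u‖ ^ 2 = ‖u + σ‖ := by
    have := congrArg norm hku
    rwa [norm_mul k, norm_pow] at this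
  have hn2 : ‖1 + 4 * k‖ * ‖1 - u‖ ^ 2 = ‖(1 + u) ^ 2 + 4 * σ‖ := by
    have := congrArg norm hk4
    rwa [norm_mul (1 + 4 * k), norm_pow] at this
  have hpar : ‖1 - u‖ ^ 2 + ‖1 + u‖ ^ 2 = 2 + 2 * ‖u‖ ^ 2 := by
    simp only [Complex.sq_norm, normSq_apply]
    simp
    ring
  have hlow : ‖1 + u‖ ^ 2 - 4 * ‖σ‖ ≤ ‖(1 + u) ^ 2 + 4 * σ‖ := by
    have := norm_sub_le ((1 + u) ^ 2 + 4 * σ) (4 * σ)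
    rw [add_sub_cancel_right, norm_pow, norm_mul] at this
    norm_num at this
    linarith
  have hup := norm_add_le u σ
  have hun : ‖u‖ = p ^ 2 * ‖b‖ := by
    rw [hu, norm_mul, norm_pow, norm_real, Real.norm_of_nonneg hp0.le]
  have hσn : 3 * (1 - p ^ 2) * ‖σ‖ ≤ p ^ 3 * (1 - ‖b‖ ^ 2) := by
    rw [hσ, norm_mul, norm_neg, norm_real, Real.norm_of_nonneg (by positivity)]
    rw [← mul_assoc, mul_div_cancel₀ _ (by positivity)]
    exact mul_le_mul_of_nonneg_left hb₁ (by positivity)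
  set r := ‖b‖
  have hr : 0 ≤ r := norm_nonneg b
  -- the reduced real inequality
  have hreal : (1 + p ^ 2) ^ 2 * ‖σ‖ ≤ p ^ 2 * (1 - r) * (1 - p ^ 4 * r) := by
    have e1 : (1 + p ^ 2) ^ 2 * (3 * (1 - p ^ 2) * ‖σ‖) ≤
        (1 + p ^ 2) ^ 2 * (p ^ 3 * (1 - r ^ 2)) :=
      mul_le_mul_of_nonneg_left hσn (by positivity)
    -- The worst case is r = 1, where dividing by 1 + p² leaves exactly the hypothesis `hp`.
    have e2 : p * (1 + p ^ 2) ^ 2 * (1 + r) ≤ 3 * (1 - p ^ 2) * (1 - p ^ 4 * r) := by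
      have a1 : p * (1 + p ^ 2) ^ 2 * (1 + r) ≤ p * (1 + p ^ 2) ^ 2 * 2 :=
        mul_le_mul_of_nonneg_left (by linarith) (by positivity)
      have a2 : 3 * (1 - p ^ 2) * (1 - p ^ 4) ≤ 3 * (1 - p ^ 2) * (1 - p ^ 4 * r) :=
        mul_le_mul_of_nonneg_left (by nlinarith [pow_pos hp0 4]) (by positivity)
      have a3 := mul_le_mul_of_nonneg_left hp (by positivity : 0 ≤ 1 + p ^ 2)
      linarith
    have e3 := mul_le_mul_of_nonneg_left e2
      (mul_nonneg (sq_nonneg p) (by linarith : 0 ≤ 1 - r))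
    have e4 : 0 < 3 * (1 - p ^ 2) := by positivity
    refine le_of_mul_le_mul_left ?_ e4
    linarith
  refine le_of_mul_le_mul_right ?_ (pow_pos hpos' 2)
  have t1 : 2 * (1 + (p ^ 2) ^ 2) * ‖k‖ * ‖1 - u‖ ^ 2 = 2 * (1 + (p ^ 2) ^ 2) * ‖u + σ‖ := by
    rw [mul_assoc, hn1]
  have t2 : p ^ 2 * (1 + ‖1 + 4 * k‖) * ‖1 - u‖ ^ 2 =
      p ^ 2 * (‖1 - u‖ ^ 2 + ‖(1 + u) ^ 2 + 4 * σ‖) := by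
    rw [← hn2]; ring
  rw [t1, t2]
  have t3 : 2 * (1 + (p ^ 2) ^ 2) * ‖u + σ‖ ≤ 2 * (1 + (p ^ 2) ^ 2) * (p ^ 2 * r + ‖σ‖) := by
    rw [← hun]
    exact mul_le_mul_of_nonneg_left hup (by positivity)
  have t4 : p ^ 2 * (2 + 2 * (p ^ 2 * r) ^ 2 - 4 * ‖σ‖) ≤
      p ^ 2 * (‖1 - u‖ ^ 2 + ‖(1 + u) ^ 2 + 4 * σ‖) := by
    refine mul_le_mul_of_nonneg_left ?_ (sq_nonneg p)
    rw [← hun]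
    linarith
  refine t3.trans (le_trans ?_ t4)
  nlinarith

/-- Taking χ = `poleToZero r` gives b = -r and equality b₁ = 1 - r² in Schwarz–Pick, so all triangle
inequalities align along the real axis. After rescaling, the value is -m, to be compared with the
tip K(-p²) = -p²/(1 + p²)². -/
theorem variabilityRegion_not_subset_koebeRegion {p : ℝ} (hp0 : 0 < p) (hp1 : p < 1)
    (hp : 3 * (1 - p ^ 2) ^ 2 < 2 * p * (1 + p ^ 2)) :
    ¬ variabilityRegion p ⊆ koebeRegion p := by
  intro hsub
  have hq : 0 < 1 - p ^ 2 := by nlinarith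
  have hp2 : -1 < p := by linarith
  -- a point of the boundary region beyond the tip of the Koebe region
  obtain ⟨r, hr0, hr1, hr⟩ : ∃ r : ℝ, 0 < r ∧ r < 1 ∧
      3 * (1 - p ^ 2) * (1 - p ^ 4 * r) < p * (1 + r) * (1 + p ^ 2) ^ 2 := by
    have hc : Continuous fun r : ℝ =>
        p * (1 + r) * (1 + p ^ 2) ^ 2 - 3 * (1 - p ^ 2) * (1 - p ^ 4 * r) := by fun_prop
    have h1 : 0 < p * (1 + 1) * (1 + p ^ 2) ^ 2 - 3 * (1 - p ^ 2) * (1 - p ^ 4 * 1) := by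
      have := mul_lt_mul_of_pos_left hp (by positivity : 0 < 1 + p ^ 2)
      linarith
    have h2 := (hc.tendsto 1).mono_left (nhdsWithin_le_nhds (s := Iio 1))
    obtain ⟨r, hr, hrI⟩ := ((h2.eventually (lt_mem_nhds h1)).and
      (Ioo_mem_nhdsLT (one_pos : (0 : ℝ) < 1))).exists
    exact ⟨r, hrI.1, hrI.2, by linarith⟩
  have hr2 : -1 < r := by linarith
  have hmem : ∀ s ∈ ball (0 : ℂ) 1, poleToZero (-p) s ∈ ball (0 : ℂ) 1 := fun s hs =>
    poleToZero_neg_mem hp0 hp1 hs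
  obtain ⟨f, hf, hfs⟩ := exists_mem_Co hp0 hp1 (ψ := fun s => poleToZero r (poleToZero (-p) s))
    (fun s hs => by
      have h1 := hasDerivAt_poleToZero (p := -p) (by linarith) (by linarith)
        (by simpa using hs.out.le : ‖s‖ ≤ 1)
      have h2 := hasDerivAt_poleToZero hr2 hr1 (by simpa using (hmem s hs).out.le :
        ‖poleToZero (-p) s‖ ≤ 1)
      exact (h2.comp s h1).differentiableAt.differentiableWithinAt)
    (fun s hs => by simpa using (poleToZero_mem hr2 hr1 (hmem s hs)).out.le)
  have hev : (fun z => poleToZero r (poleToZero (-p) (poleToZero p z))) =ᶠ[𝓝 0] poleToZero r := by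
    filter_upwards [isOpen_ball.mem_nhds (by simp : (0 : ℂ) ∈ ball (0 : ℂ) 1)] with z hz
    rw [poleToZero_neg_left hp2 hp1 (by simpa using hz.out.le)]
  have hev0 : poleToZero r (poleToZero (-p) (poleToZero p 0)) = poleToZero r 0 := hev.self_of_nhds
  rw [hev.deriv_eq, hev0, (hasDerivAt_poleToZero hr2 hr1 (by simp)).deriv,
    poleToZero_zero] at hfs
  set m : ℝ := p ^ 2 * (r + p * (1 - r ^ 2) / (3 * (1 - p ^ 2))) / (1 + p ^ 2 * r) ^ 2 with hm
  have hden : 0 < 1 + p ^ 2 * r := by positivity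
  have hr3 : 0 < 1 - r ^ 2 := by nlinarith
  have hm0 : 0 < m := by positivity
  have hfm : -((p ^ 2 / (1 - p ^ 2) ^ 2 : ℝ) : ℂ) * feketeSzego 1 f = ((-m : ℝ) : ℂ) := by
    have : feketeSzego 1 f = (((1 - p ^ 2) ^ 2 * (r + p * (1 - r ^ 2) / (3 * (1 - p ^ 2))) /
        (1 + p ^ 2 * r) ^ 2 : ℝ) : ℂ) := by
      rw [hfs]
      have e1 : ((1 - p ^ 2 : ℝ) : ℂ) ≠ 0 := ofReal_ne_zero.mpr hq.ne'
      push_cast at e1 ⊢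
      have e2 : 1 - (p : ℂ) ^ 2 * -(r : ℂ) = 1 + (p : ℂ) ^ 2 * r := by ring
      rw [e2]
      congr 1
      field_simp
      ring
    rw [this, ← ofReal_neg, ← ofReal_mul, hm]
    congr 1
    field_simp
  have hin := hsub ⟨f, hf, rfl⟩
  rw [mem_koebeRegion_iff hp0 hp1, exists_koebe_eq_iff (by positivity : 0 < p ^ 2) (by nlinarith),
    hfm, norm_real, norm_neg, Real.norm_of_nonneg hm0.le,
    show (1 : ℂ) + 4 * ((-m : ℝ) : ℂ) = ((1 - 4 * m : ℝ) : ℂ) by push_cast; ring, norm_real,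
    Real.norm_eq_abs] at hin
  have hmbig : p ^ 2 < m * (1 + p ^ 2) ^ 2 := by
    rw [hm, div_mul_eq_mul_div, lt_div_iff₀ (by positivity)]
    have e1 : (1 + p ^ 2 * r) ^ 2 <
        (r + p * (1 - r ^ 2) / (3 * (1 - p ^ 2))) * (1 + p ^ 2) ^ 2 := by
      have e2 : (1 + p ^ 2 * r) ^ 2 = r * (1 + p ^ 2) ^ 2 + (1 - r) * (1 - p ^ 4 * r) := by ring
      have e3 : (1 - r) * (1 - p ^ 4 * r) <
          p * (1 - r ^ 2) / (3 * (1 - p ^ 2)) * (1 + p ^ 2) ^ 2 := by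
        rw [div_mul_eq_mul_div, lt_div_iff₀ (by positivity)]
        have := mul_lt_mul_of_pos_left hr (by linarith : 0 < 1 - r)
        linarith
      linarith
    have := mul_lt_mul_of_pos_left e1 (by positivity : 0 < p ^ 2)
    linarith
  -- For 4m ≤ 1 the criterion says m(1 + p²)² ≤ p²; otherwise it would give m(1 - p²)² ≤ 0.
  rcases abs_cases (1 - 4 * m) with ⟨h, -⟩ | ⟨h, -⟩
  · rw [h] at hin
    linarith
  · rw [h] at hin
    nlinarith [mul_pos hm0 (mul_pos hq hq)]

/-! ### The critical parameter. -/

theorem le_criticalP_iff {p : ℝ} (hp0 : 0 < p) (hp1 : p < 1) :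
    p ≤ criticalP ↔ 2 * p * (1 + p ^ 2) ≤ 3 * (1 - p ^ 2) ^ 2 := by
  rw [criticalP]
  set c := √37 with hc
  have hc2 : c ^ 2 = 37 := Real.sq_sqrt (by norm_num)
  have hc6 : 6 < c := Real.lt_sqrt_of_sq_lt (by norm_num)
  set d := √(2 * (1 + c)) with hd
  have hd2 : d ^ 2 = 2 * (1 + c) := Real.sq_sqrt (by linarith)
  have hd0 : 0 ≤ d := Real.sqrt_nonneg _
  -- In x = p + 1/p the palindromic quartic is p²(3x² - 2x - 12), with roots x = (1 ± √37)/3. On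
  -- (0,1) only the factor vanishing at `criticalP` changes sign.
  have hfac : 3 * (1 - p ^ 2) ^ 2 - 2 * p * (1 + p ^ 2) =
      3 * (p ^ 2 + (c - 1) / 3 * p + 1) * ((1 + c + d) / 6 - p) * ((1 + c - d) / 6 - p) := by
    have e : ((1 + c + d) / 6 - p) * ((1 + c - d) / 6 - p) = p ^ 2 - (1 + c) / 3 * p + 1 := by
      linear_combination hc2 / 36 - hd2 / 36
    rw [mul_assoc _ ((1 + c + d) / 6 - p), e]
    linear_combination p ^ 2 / 3 * hc2
  have hpos : 0 < 3 * (p ^ 2 + (c - 1) / 3 * p + 1) * ((1 + c + d) / 6 - p) := by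
    apply mul_pos
    · have : 0 < (c - 1) / 3 := by linarith
      positivity
    · linarith
  rw [← sub_nonneg (b := p), ← sub_nonneg (b := 2 * p * (1 + p ^ 2)), hfac]
  exact (mul_nonneg_iff_of_pos_left hpos).symm

theorem abs_criticalP_sub_lt : |criticalP - 0.553175| < 1 / 10 ^ 6 := by
  rw [criticalP]
  have h1 : 6.0827625 < √37 := Real.lt_sqrt_of_sq_lt (by norm_num)
  have h2 : √37 < 6.0827626 := (Real.sqrt_lt' (by norm_num)).mpr (by norm_num)
  have h3 : 3.763711 < √(2 * (1 + √37)) := Real.lt_sqrt_of_sq_lt (by norm_num; linarith)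
  have h4 : √(2 * (1 + √37)) < 3.763712 := (Real.sqrt_lt' (by norm_num)).mpr (by norm_num; linarith)
  generalize √(2 * (1 + √37)) = d at *
  generalize √37 = c at *
  rw [abs_lt]
  constructor <;> norm_num <;> linarith

end ConcaveFunctions

theorem theorem7 :
    (∀ p : ℝ, 0 < p → p < 1 →
      ConcaveFunctions.koebeRegion p ⊆ ConcaveFunctions.variabilityRegion p ∧
      ConcaveFunctions.variabilityRegion p ⊆ Metric.closedBall (0 : ℂ) 1 ∧
      (ConcaveFunctions.variabilityRegion p = ConcaveFunctions.koebeRegion p ↔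
        p ≤ ConcaveFunctions.criticalP)) ∧
    |ConcaveFunctions.criticalP - 0.553175| < 1 / 10 ^ 6 := by
  refine ⟨fun p hp0 hp1 => ⟨ConcaveFunctions.koebeRegion_subset hp0 hp1,
    ConcaveFunctions.variabilityRegion_subset_closedBall hp0 hp1, ?_⟩,
    ConcaveFunctions.abs_criticalP_sub_lt⟩
  rw [ConcaveFunctions.le_criticalP_iff hp0 hp1]
  constructor
  · intro h
    by_contra! hlt
    exact ConcaveFunctions.variabilityRegion_not_subset_koebeRegion hp0 hp1 hlt h.subset
  · exact fun h => (ConcaveFunctions.variabilityRegion_subset_koebeRegion hp0 hp1 h).antisymm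
      (ConcaveFunctions.koebeRegion_subset hp0 hp1)
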